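/- Let $m\ge 1$ be an integer. For $q\in(1,m+1]$, a $q$-expansion of $x\in[0,\frac m{q-1}]$ is a sequence $(c_i)_{i\ge1}$ in $\{0,\dots,m\}^{\mathbb N}$ with $x=\sum_{i\ge1}c_iq^{-i}$. Let $\mathcal U_q$ be the set of $x$ having exactly one $q$-expansion, $\mathcal U_q'$ the set of the $q$-expansions of the elements of $\mathcal U_q$, and $\mathcal U=\{q\in(1,m+1]:1\in\mathcal U_q\}$, with topological closure $\overline{\mathcal U}$. Sequences, and words of equal length, are ordered lexicographically. The greedy expansion $\beta(q)$ of $1$ is its largest $q$-expansion; the quasi-greedy expansion $\alpha(q)$ is the largest $q$-expansion of $1$ that has no last nonzero digit. The reflection of a word or sequence replaces each digit $d$ by $m-d$ and is denoted by a bar; $w^+$ is the word $w$ with its last digit increased by $1$. Let $M=\lfloor m/2\rfloor+1$, and let $(q_0,q_0^*)$ be a connected component of $(M,m+1]\setminus\overline{\mathcal U}$ with $q_0>M$. Let $a=a_1\cdots a_n$ be the shortest nonempty word with $\alpha(q_0)=a^\infty$. Put $c_0=a^+$ (so $c_0^-=a$) and $c_{\ell+1}=c_\ell\,\overline{c_\ell}^{\,+}$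 for $\ell\ge0$. For $\ell\ge1$ let $q_\ell>1$ be the base with $\beta(q_\ell)=c_\ell0^\infty$. A word $u_1\cdots u_p$ over $\{0,\dots,m\}$ with $p\ge1$ is matched to $a$ if $u_p<m$ and, for every $1\le k\le p$, the word $v$ formed by the $n$ letters of $u_1\cdots u_pa_1\cdots a_n$ at the positions $k+1,\dots,k+n$ satisfies $v\le a$ whenever $u_1\cdots u_k\ne m^k$, and $v\ge\overline a$ whenever $u_1\cdots u_k\ne0^k$. Let $\ell\ge1$ and $q\in(q_\ell,q_{\ell+1}]$. Then a sequence $(b_i)$ belongs to $\mathcal U_q'\setminus\mathcal U_{q_0}'$ if and only if $(b_i)$ or its reflection is an infinite sequence of the form $$\omega\,(c_0^-)^{j}(c_{i_1}\overline{c_{i_1}})^{j_1}(c_{i_1}\overline{c_{i_2}})^{l_1}(c_{i_2}\overline{c_{i_2}})^{j_2}\cdots(c_{i_{r-1}}\overline{c_{i_r}})^{l_{r-1}}(c_{i_r}\overline{c_{i_r}})^{j_r},$$ where $\omega$ is a word matched to $a$, $r\ge1$, $0\le i_1<i_2<\cdots<i_r<\ell$ are integers, $j\in\{0,\infty\}$,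 each $l_s\in\{0,1\}$ and each $j_s\in\{0,1,2,\dots\}\cup\{\infty\}$; whatever follows the first infinite power is disregarded. -/

import Mathlib

open Set

namespace UniqueExpansion

/-! ### Expansions in non-integer bases

Digit sequences `c₁c₂⋯` are functions `c : ℕ → ℕ`, where `c i` is the digit `cᵢ₊₁`. -/

/-- `c` is a `q`-expansion of `x` with respect to the digit set `{0, …, m}`. -/
def IsExpansion (m : ℕ) (q x : ℝ) (c : ℕ → ℕ) : Prop :=
  (∀ i, c i ≤ m) ∧ HasSum (fun i => (c i : ℝ) / q ^ (i + 1)) x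

/-- The set `U_q` of the `x ∈ [0, m/(q-1)]` that have a unique `q`-expansion. -/
def univoqueSet (m : ℕ) (q : ℝ) : Set ℝ :=
  {x | x ∈ Icc (0 : ℝ) (m / (q - 1)) ∧ ∃! c, IsExpansion m q x c}

/-- The set `U'_q` of the `q`-expansions of the elements of `U_q`. -/
def univoqueSeqs (m : ℕ) (q : ℝ) : Set (ℕ → ℕ) :=
  {c | ∃ x ∈ univoqueSet m q, IsExpansion m q x c}

/-- The set `U` of the bases `q ∈ (1, m+1]` in which `1` has a unique expansion. -/
def univoqueBases (m : ℕ) : Set ℝ :=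
  {q | q ∈ Ioc (1 : ℝ) (m + 1) ∧ (1 : ℝ) ∈ univoqueSet m q}

/-- A sequence is infinite if it does not have a last nonzero digit. -/
def IsInfiniteSeq (c : ℕ → ℕ) : Prop :=
  ¬ ∃ N, c N ≠ 0 ∧ ∀ i, N < i → c i = 0

/-- `c` is the greedy `q`-expansion of `x`: the lexicographically largest one. -/
def IsGreedy (m : ℕ) (q x : ℝ) (c : ℕ → ℕ) : Prop :=
  IsExpansion m q x c ∧ ∀ d, IsExpansion m q x d → toLex d ≤ toLex c

/-- `c` is the quasi-greedy `q`-expansion of `x`: the lexicographically largest infinite one. -/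
def IsQuasiGreedy (m : ℕ) (q x : ℝ) (c : ℕ → ℕ) : Prop :=
  IsExpansion m q x c ∧ IsInfiniteSeq c ∧
    ∀ d, IsExpansion m q x d → IsInfiniteSeq d → toLex d ≤ toLex c

/-! ### Words -/

/-- The reflection of a word. -/
def reflectWord (m : ℕ) (w : List ℕ) : List ℕ := w.map (fun d => m - d)

/-- The reflection of a sequence. -/
def reflectSeq (m : ℕ) (b : ℕ → ℕ) : ℕ → ℕ := fun i => m - b i

/-- `w⁺`: the last digit of the (nonempty) word `w` is increased by one. -/
def plusWord (w : List ℕ) : List ℕ := w.dropLast ++ [w.getLastD 0 + 1]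

/-- The sequence `w^∞` (for a nonempty word `w`). -/
def periodicSeq (w : List ℕ) : ℕ → ℕ := fun i => w.getD (i % w.length) 0

/-- The sequence `w b₁b₂⋯`. -/
def prependWord (w : List ℕ) (b : ℕ → ℕ) : ℕ → ℕ :=
  fun i => if i < w.length then w.getD i 0 else b (i - w.length)

/-- The words `c_ℓ` generated by `a = c₀⁻`: `c₀ = a⁺` and `c_{ℓ+1} = c_ℓ (reflection of c_ℓ)⁺`. -/
def cWord (m : ℕ) (a : List ℕ) : ℕ → List ℕ
  | 0 => plusWord a
  | ℓ + 1 => cWord m a ℓ ++ plusWord (reflectWord m (cWord m a ℓ))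

/-- `a` is the shortest nonempty word with `α(q) = a^∞`, where `α(q)` is the quasi-greedy
`q`-expansion of `1`. -/
def IsSmallestPeriodicBlock (m : ℕ) (q : ℝ) (a : List ℕ) : Prop :=
  a ≠ [] ∧ IsQuasiGreedy m q 1 (periodicSeq a) ∧
    ∀ w : List ℕ, w ≠ [] → periodicSeq w = periodicSeq a → a.length ≤ w.length

/-- The nonempty word `u` over `{0, …, m}` is matched to `a`. Words of equal length are compared
lexicographically. -/
def IsMatched (m : ℕ) (a u : List ℕ) : Prop :=
  u ≠ [] ∧ (∀ d ∈ u, d ≤ m) ∧ u.getLastD 0 < m ∧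
    ∀ k, 1 ≤ k → k ≤ u.length →
      (u.take k ≠ List.replicate k m → ((u ++ a).drop k).take a.length ≤ a) ∧
      (u.take k ≠ List.replicate k 0 →
        reflectWord m a ≤ ((u ++ a).drop k).take a.length)

/-- Finite or infinite words. -/
inductive ExtWord where
  | fin (w : List ℕ) : ExtWord
  | inf (b : ℕ → ℕ) : ExtWord

/-- Concatenation; nothing after an infinite word is reached. -/
def ExtWord.append : ExtWord → ExtWord → ExtWord
  | .fin u, .fin v => .fin (u ++ v)
  | .fin u, .inf b => .inf (prependWord u b)
  | .inf b, _ => .inf b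

/-- The power `w^j` of a nonempty word, `0 ≤ j ≤ ∞`. -/
def wordPow (w : List ℕ) : ℕ∞ → ExtWord
  | ⊤ => .inf (periodicSeq w)
  | (j : ℕ) => .fin (List.replicate j w).flatten

/-- The product
`(c_{i₀} c̄_{i₀})^{j₀} (c_{i₀} c̄_{i₁})^{l₀} (c_{i₁} c̄_{i₁})^{j₁} ⋯ (c_{i_{r-1}} c̄_{i_r})^{l_{r-1}} (c_{i_r} c̄_{i_r})^{j_r}`,
where the bar is reflection. -/
def blockProduct (m : ℕ) (a : List ℕ) (i : ℕ → ℕ) (j : ℕ → ℕ∞) (l : ℕ → ℕ) : ℕ → ExtWord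
  | 0 => wordPow (cWord m a (i 0) ++ reflectWord m (cWord m a (i 0))) (j 0)
  | r + 1 =>
    ((blockProduct m a i j l r).append
      (wordPow (cWord m a (i r) ++ reflectWord m (cWord m a (i (r + 1)))) (l r))).append
      (wordPow (cWord m a (i (r + 1)) ++ reflectWord m (cWord m a (i (r + 1)))) (j (r + 1)))

/-- `b` is an infinite sequence of the form
`ω a^e (c_{i₀} c̄_{i₀})^{j₀} (c_{i₀} c̄_{i₁})^{l₀} ⋯ (c_{i_r} c̄_{i_r})^{j_r}` with `ω` matched to `a`,
`e ∈ {0, ∞}`, `0 ≤ i₀ < ⋯ < i_r < ℓ`, `0 ≤ j_s ≤ ∞` and `0 ≤ l_s ≤ 1`. -/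
def HasBlockForm (m : ℕ) (a : List ℕ) (ℓ : ℕ) (b : ℕ → ℕ) : Prop :=
  ∃ (ω : List ℕ) (e : ℕ∞) (r : ℕ) (i : ℕ → ℕ) (j : ℕ → ℕ∞) (l : ℕ → ℕ),
    IsMatched m a ω ∧ (e = 0 ∨ e = ⊤) ∧
    (∀ s < r, i s < i (s + 1)) ∧ i r < ℓ ∧ (∀ s < r, l s ≤ 1) ∧
    ((ExtWord.fin ω).append (wordPow a e)).append (blockProduct m a i j l r) = ExtWord.inf b

/-- `(q₀, q₀*)` is a connected component of `(M, m+1] ∖ closure U`, where `M = ⌊m/2⌋ + 1`. -/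
def IsComponent (m : ℕ) (q₀ q₀' : ℝ) : Prop :=
  ∃ x ∈ Ioc ((m / 2 + 1 : ℕ) : ℝ) (m + 1) \ closure (univoqueBases m),
    connectedComponentIn (Ioc ((m / 2 + 1 : ℕ) : ℝ) (m + 1) \ closure (univoqueBases m)) x
      = Ioo q₀ q₀'

end UniqueExpansion

/-! Let A = α(q₀) = a^∞, n = |a| and g = (c_ℓ c̄_ℓ)^∞. A sequence is the unique expansion of its
value iff each tail after a digit < m, and each reflected tail after a digit > 0, has value < 1
(`mem_univoqueSeqs_iff`). Such bounds become lexicographic: a sequence at or above an expansion of 1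
that dominates its own tails has value at least 1 (`one_le_val`), and tails lying lexicographically
below a sequence of value at most 1 have value < 1, given one source of strictness
(`val_shift_lt_one`). The sequence to compare with is A in base q₀ and g in base q_{ℓ+1}, since c_ℓ
c̄_ℓ is c_{ℓ+1} with its last digit lowered. Above q_ℓ the value of c_ℓ0^∞ drops below 1, so tails
below c_ℓ are good enough.

All tails of A are at most A because A is quasi-greedy. All reflected tails are at most A because q₀
is approximated by bases u ≤ q₀ in U, whose unique expansions of 1 start like A. These bounds pass
to a⁺ and, by doubling, to every c_k (`Admissible.double`, `isTower_towerSeq`).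

If b is univoque in base q ≤ q_{ℓ+1} but not in q₀, its tails are bounded by g, while some tail of b
or of its reflection reaches A. Cut at the first such place. What precedes is matched to a; what
follows is A, or some copies of a (absorbed into ω) and then a sequence starting with c₀ = a⁺. A
tail starting with c_k continues to c_{k+1} or is followed by c̄_k, because c̄_k and c̄_k⁺ are
neighbours in the order; it never reaches c_ℓ, because of the bound g. Reading off the longest c_k
again and again yields the product of blocks (`exists_blockProduct`).

Conversely, prepending c_k c̄_{k'} to a sequence that starts with c_{k'}, k ≤ k' < ℓ, keeps all
tails and reflected tails below c_ℓ (`IsBlockSeq.cons`), so the product is univoque above q_ℓ; but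
the tail after ω is at least A, which rules out base q₀. -/

namespace UniqueExpansion

/-! ### Lexicographic comparison of sequences -/

/-- The sequence `s` without its first `k` digits. -/
def shift (k : ℕ) (s : ℕ → ℕ) : ℕ → ℕ := fun i => s (k + i)

/-- Among their first `n` digits, `s` and `t` differ, and `s` is the smaller one. -/
def LtUpTo (n : ℕ) (s t : ℕ → ℕ) : Prop := ∃ d < n, (∀ i < d, s i = t i) ∧ s d < t d

/-- `s` and `t` have the same first `n` digits. -/
def Agree (n : ℕ) (s t : ℕ → ℕ) : Prop := ∀ i < n, s i = t i

theorem shift_zero (s : ℕ → ℕ) : shift 0 s = s := by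
  funext i; simp [shift]

theorem shift_shift (j k : ℕ) (s : ℕ → ℕ) : shift j (shift k s) = shift (k + j) s := by
  funext i; simp [shift, add_assoc]

theorem shift_reflectSeq (m k : ℕ) (s : ℕ → ℕ) :
    shift k (reflectSeq m s) = reflectSeq m (shift k s) := rfl

theorem reflectSeq_reflectSeq {m : ℕ} {s : ℕ → ℕ} (hs : ∀ i, s i ≤ m) :
    reflectSeq m (reflectSeq m s) = s := by
  funext i; have := hs i; simp only [reflectSeq]; omega

theorem reflectSeq_le (m : ℕ) (s : ℕ → ℕ) (i : ℕ) : reflectSeq m s i ≤ m := Nat.sub_le _ _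

theorem lex_lt_iff {s t : ℕ → ℕ} :
    toLex s < toLex t ↔ ∃ d, (∀ i < d, s i = t i) ∧ s d < t d := Iff.rfl

theorem LtUpTo.lex_lt {n : ℕ} {s t : ℕ → ℕ} (h : LtUpTo n s t) : toLex s < toLex t := by
  obtain ⟨d, -, h1, h2⟩ := h
  exact ⟨d, h1, h2⟩

theorem ltUpTo_trichotomy (n : ℕ) (s t : ℕ → ℕ) :
    LtUpTo n s t ∨ Agree n s t ∨ LtUpTo n t s := by
  induction n with
  | zero => right; left; intro i hi; omega
  | succ n ih =>
    rcases ih with ⟨d, h1, h2⟩ | h | ⟨d, h1, h2⟩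
    · exact Or.inl ⟨d, by omega, h2⟩
    · rcases lt_trichotomy (s n) (t n) with h1 | h1 | h1
      · exact Or.inl ⟨n, by omega, h, h1⟩
      · refine Or.inr (Or.inl fun i hi => ?_)
        rcases Nat.lt_succ_iff_lt_or_eq.mp hi with h2 | rfl
        exacts [h i h2, h1]
      · exact Or.inr (Or.inr ⟨n, by omega, fun i hi => (h i hi).symm, h1⟩)
    · exact Or.inr (Or.inr ⟨d, by omega, h2⟩)

theorem LtUpTo.mono {n n' : ℕ} {s t : ℕ → ℕ} (h : LtUpTo n s t) (hn : n ≤ n') :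
    LtUpTo n' s t := by
  obtain ⟨d, h1, h2⟩ := h
  exact ⟨d, h1.trans_le hn, h2⟩

theorem LtUpTo.congr {n : ℕ} {s t s' t' : ℕ → ℕ} (h : LtUpTo n s t) (hs : Agree n s s')
    (ht : Agree n t t') : LtUpTo n s' t' := by
  obtain ⟨d, h1, h2, h3⟩ := h
  refine ⟨d, h1, fun i hi => ?_, ?_⟩
  · rw [← hs i (hi.trans h1), ← ht i (hi.trans h1), h2 i hi]
  · rwa [← hs d h1, ← ht d h1]

theorem Agree.symm {n : ℕ} {s t : ℕ → ℕ} (h : Agree n s t) : Agree n t s :=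
  fun i hi => (h i hi).symm

theorem Agree.mono {n n' : ℕ} {s t : ℕ → ℕ} (h : Agree n s t) (hn : n' ≤ n) : Agree n' s t :=
  fun i hi => h i (hi.trans_le hn)

theorem not_ltUpTo_of_lex_le {n : ℕ} {s t : ℕ → ℕ} (h : toLex s ≤ toLex t) :
    ¬ LtUpTo n t s := fun h' => absurd h'.lex_lt (not_lt.mpr h)

/-- After a common prefix, the comparison of two sequences is that of their remainders. -/
theorem lex_lt_shift {k : ℕ} {s t : ℕ → ℕ} (h : Agree k s t) (hlt : toLex s < toLex t) :
    toLex (shift k s) < toLex (shift k t) := by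
  obtain ⟨d, h1, h2⟩ := lex_lt_iff.mp hlt
  have hd : k ≤ d := by
    by_contra hd
    have := h d (by omega)
    omega
  exact lex_lt_iff.mpr ⟨d - k, fun i hi => h1 _ (by omega),
    by simpa [shift, Nat.add_sub_cancel' hd] using h2⟩

theorem lex_le_shift {k : ℕ} {s t : ℕ → ℕ} (h : Agree k s t) (hle : toLex s ≤ toLex t) :
    toLex (shift k s) ≤ toLex (shift k t) := by
  rcases hle.lt_or_eq with h1 | h1
  · exact (lex_lt_shift h h1).le
  · rw [toLex.injective h1]

theorem lex_le_head {s t : ℕ → ℕ} (h : toLex s ≤ toLex t) : s 0 ≤ t 0 := by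
  by_contra h1
  exact absurd (lex_lt_iff.mpr ⟨0, by simp, not_le.mp h1⟩) (not_lt.mpr h)

/-- Until the first discrepancy every digit equals its predecessor, hence m, and no digit exceeds m.
-/
theorem shift_one_le {m : ℕ} {g : ℕ → ℕ} (hg : ∀ i, g i ≤ m) (h0 : g 0 = m) :
    toLex (shift 1 g) ≤ toLex g := by
  by_contra hlt
  obtain ⟨d, h1, h2⟩ := lex_lt_iff.mp (not_le.mp hlt)
  have : ∀ i ≤ d, g i = m := by
    intro i hi
    induction i with
    | zero => exact h0
    | succ i ih =>
      have := h1 i (by omega)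
      simp only [shift] at this
      rw [add_comm i 1, ← this, ih (by omega)]
  have h3 := this d le_rfl
  have h4 := hg (1 + d)
  simp only [shift] at h2
  omega

/-- A strict bound on the tails after digits smaller than `m` holds for all tails after the
first such digit. -/
theorem lex_lt_of_exists_lt {m : ℕ} {b g : ℕ → ℕ} (hb : ∀ i, b i ≤ m) (hg : ∀ i, g i ≤ m)
    (K : ℕ) (h : ∀ i < K, b i < m → toLex (shift (i + 1) b) < toLex g) (hK : ∃ i < K, b i < m) :
    toLex (shift K b) < toLex g := by
  induction K with
  | zero => obtain ⟨i, hi, -⟩ := hK; omega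
  | succ K ih =>
    by_cases hbK : b K < m
    · exact h K (by omega) hbK
    obtain ⟨i, hi, hbi⟩ := hK
    -- A digit m at `K` forces `g 0 = m`. Deleting this common digit keeps the inequality, and
    -- `shift_one_le` absorbs the shift of `g`.
    have hKm : b K = m := le_antisymm (hb K) (not_lt.mp hbK)
    have hi' : i < K := by
      rcases Nat.lt_succ_iff_lt_or_eq.mp hi with h1 | rfl
      exacts [h1, absurd hbi hbK]
    have h1 := ih (fun i hi => h i (by omega)) ⟨i, hi', hbi⟩
    have h0 : g 0 = m := by
      have := lex_le_head h1.le
      simp only [shift, add_zero] at this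
      have := hg 0
      omega
    have h2 : toLex (shift 1 (shift K b)) < toLex (shift 1 g) :=
      lex_lt_shift (fun i hi => by
        obtain rfl : i = 0 := by omega
        simp [shift, hKm, h0]) h1
    rw [shift_shift] at h2
    exact h2.trans_le (shift_one_le hg h0)

/-- A bound on the tails of `g` after digits smaller than `m` holds for all tails. -/
theorem lex_le_self_of_forall {m : ℕ} {g : ℕ → ℕ} (hg : ∀ i, g i ≤ m)
    (h : ∀ i, g i < m → toLex (shift (i + 1) g) ≤ toLex g) (K : ℕ) :
    toLex (shift K g) ≤ toLex g := by
  induction K with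
  | zero => rw [shift_zero]
  | succ K ih =>
    by_cases hK : g K < m
    · exact h K hK
    have hKm : g K = m := le_antisymm (hg K) (not_lt.mp hK)
    have h0 : g 0 = m := by
      have := lex_le_head ih
      simp only [shift, add_zero] at this
      have := hg 0
      omega
    have h2 : toLex (shift 1 (shift K g)) ≤ toLex (shift 1 g) :=
      lex_le_shift (fun i hi => by
        obtain rfl : i = 0 := by omega
        simp [shift, hKm, h0]) ih
    rw [shift_shift] at h2
    exact h2.trans (shift_one_le hg h0)

/-- The same for reflected tails. -/
theorem reflectSeq_lex_le_of_forall {m : ℕ} {g : ℕ → ℕ} (hg : ∀ i, g i ≤ m)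
    (h0 : toLex (reflectSeq m g) ≤ toLex g)
    (h : ∀ i, 0 < g i → toLex (reflectSeq m (shift (i + 1) g)) ≤ toLex g) (K : ℕ) :
    toLex (reflectSeq m (shift K g)) ≤ toLex g := by
  induction K with
  | zero => rwa [shift_zero]
  | succ K ih =>
    by_cases hK : 0 < g K
    · exact h K hK
    have hK0 : g K = 0 := by omega
    have h0 : g 0 = m := by
      have := lex_le_head ih
      simp only [shift, reflectSeq, add_zero] at this
      have := hg 0
      omega
    have h2 : toLex (shift 1 (reflectSeq m (shift K g))) ≤ toLex (shift 1 g) :=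
      lex_le_shift (fun i hi => by
        obtain rfl : i = 0 := by omega
        simp [shift, reflectSeq, hK0, h0]) ih
    rw [shift_reflectSeq, shift_shift] at h2
    exact h2.trans (shift_one_le hg h0)

/-! ### The limit of the words `c_k` -/

/-- The bounds on the proper suffixes of the word formed by the first `N` digits of `C`. -/
def Admissible (m N : ℕ) (C : ℕ → ℕ) : Prop :=
  ∀ i, 0 < i → i < N → ¬ LtUpTo (N - i) C (shift i C) ∧
    LtUpTo (N - i) (reflectSeq m (shift i C)) C

/-- A suffix starting in the first half that agrees with the prefix up to the middle is then decided
by the reflected bound at `N - i`, because the second half is essentially the reflection of the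
first. For a suffix inside the second half the two bounds swap roles: the extra 1 weakens the strict
bound to a weak one and turns the weak bound into a strict one. This is why `Admissible` is strict
only for reflected suffixes. -/
theorem Admissible.double {m N : ℕ} {C : ℕ → ℕ} (hN : 0 < N)
    (hle : ∀ i < N, C i ≤ m) (h0 : m - C 0 < C 0) (hlast : 0 < C (N - 1))
    (hs : ∀ i < N, C (N + i) = m - C i + if i + 1 = N then 1 else 0)
    (h : Admissible m N C) : Admissible m (N * 2) C := by
  have hs1 : ∀ i, i + 1 < N → C (N + i) = m - C i := fun i hi => by
    rw [hs i (by omega), if_neg (by omega), add_zero]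
  have hs2 : C (N + (N - 1)) = m - C (N - 1) + 1 := by
    rw [hs _ (by omega), if_pos (by omega)]
  intro i hi0 hi
  rcases lt_trichotomy i N with hiN | rfl | hiN
  · refine ⟨?_, (h i hi0 hiN).2.mono (by omega)⟩
    rintro ⟨d, hd, hag, hlt⟩
    obtain ⟨f, hf, hfag, hflt⟩ := (h (N - i) (by omega) (by omega)).2
    have hdN : N - i ≤ d := by
      by_contra hdN
      exact (h i hi0 hiN).1 ⟨d, by omega, hag, hlt⟩
    simp only [shift, reflectSeq] at *
    have e1 : ∀ e ≤ f, C (i + (N - i + e)) = m - C e := fun e he => by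
      rw [← hs1 e (by omega)]; congr 1; omega
    have e2 : C (N - i + f) ≤ m := hle _ (by omega)
    have e3 : C f ≤ m := hle _ (by omega)
    rcases lt_or_ge (N - i + f) d with h1 | h1
    · have := hag _ h1
      rw [e1 f le_rfl] at this
      omega
    · obtain ⟨e, rfl⟩ := Nat.exists_eq_add_of_le hdN
      rw [e1 e (by omega)] at hlt
      have e4 : C e ≤ m := hle _ (by omega)
      rcases lt_or_ge e f with h2 | h2
      · have := hfag e h2
        have e5 : C (N - i + e) ≤ m := hle _ (by omega)
        omega
      · obtain rfl : e = f := by omega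
        omega
  · constructor
    · rintro ⟨d, hd, hag, hlt⟩
      simp only [shift] at *
      rcases Nat.eq_zero_or_pos d with rfl | hd0
      · rw [hs 0 hN] at hlt
        split_ifs at hlt <;> omega
      · have := hag 0 hd0
        rw [hs1 0 (by omega)] at this
        omega
    · refine ⟨i - 1, by omega, fun e he => ?_, ?_⟩
      · have := hle e (by omega)
        simp only [shift, reflectSeq]
        rw [hs1 e (by omega)]
        omega
      · have := hle (i - 1) (by omega)
        simp only [shift, reflectSeq]
        rw [hs2]
        omega
  · obtain ⟨k, rfl⟩ := Nat.exists_eq_add_of_le hiN.le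
    obtain ⟨hu, hl⟩ := h k (by omega) (by omega)
    have hlen : N * 2 - (N + k) = N - k := by omega
    rw [hlen]
    constructor
    · rintro ⟨d, hd, hag, hlt⟩
      obtain ⟨f, hf, hfag, hflt⟩ := hl
      simp only [shift, reflectSeq, add_assoc] at *
      rcases lt_trichotomy d f with h1 | rfl | h1
      · have := hfag d h1
        rw [hs1 (k + d) (by omega)] at hlt
        omega
      · rw [hs (k + d) (by omega)] at hlt
        split_ifs at hlt <;> omega
      · have := hag f h1
        rw [hs1 (k + f) (by omega)] at this
        omega
    · have key : ∀ e, k + e + 1 < N → m - C (N + (k + e)) = C (k + e) := fun e he => by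
        have := hle (k + e) (by omega)
        rw [hs1 _ he]; omega
      have key2 : m - C (N + (N - 1)) = C (N - 1) - 1 := by
        have := hle (N - 1) (by omega)
        rw [hs2]; omega
      rcases ltUpTo_trichotomy (N - k) C (shift k C) with h1 | h1 | ⟨d, hd, hag, hlt⟩
      · exact absurd h1 hu
      · refine ⟨N - k - 1, by omega, fun e he => ?_, ?_⟩
        · simp only [shift, reflectSeq, add_assoc]
          rw [key e (by omega)]
          exact (h1 e (by omega)).symm
        · have h2 := h1 (N - k - 1) (by omega)
          simp only [shift, reflectSeq, add_assoc] at *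
          have : k + (N - k - 1) = N - 1 := by omega
          rw [this] at h2 ⊢
          omega
      · refine ⟨d, hd, fun e he => ?_, ?_⟩
        · simp only [shift, reflectSeq, add_assoc]
          rw [key e (by omega)]
          exact hag e he
        · simp only [shift, reflectSeq, add_assoc] at *
          by_cases h2 : k + d + 1 < N
          · rw [key d h2]; exact hlt
          · have : k + d = N - 1 := by omega
            rw [this] at hlt ⊢
            omega

/-- `C` is the limit of the words `c_k`, where `c_k` has length `n 2^k`. -/
structure IsTower (m n : ℕ) (C : ℕ → ℕ) : Prop where
  pos : 0 < n
  le₀ : ∀ i < n, C i ≤ m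
  reflect_lt : m - C 0 < C 0
  last_pos₀ : 0 < C (n - 1)
  succ : ∀ k i, i < n * 2 ^ k →
    C (n * 2 ^ k + i) = m - C i + if i + 1 = n * 2 ^ k then 1 else 0
  admissible₀ : Admissible m n C

namespace IsTower

variable {m n : ℕ} {C : ℕ → ℕ}

theorem len_pos (h : IsTower m n C) (k : ℕ) : 0 < n * 2 ^ k :=
  Nat.mul_pos h.pos (by positivity)

theorem succ_lt (h : IsTower m n C) {k i : ℕ} (hi : i + 1 < n * 2 ^ k) :
    C (n * 2 ^ k + i) = m - C i := by
  rw [h.succ k i (by omega), if_neg (by omega), add_zero]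

theorem succ_last (h : IsTower m n C) (k : ℕ) :
    C (n * 2 ^ k + (n * 2 ^ k - 1)) = m - C (n * 2 ^ k - 1) + 1 := by
  have := h.len_pos k
  rw [h.succ k _ (by omega), if_pos (by omega)]

theorem last_pos (h : IsTower m n C) (k : ℕ) : 0 < C (n * 2 ^ k - 1) := by
  cases k with
  | zero => simpa using h.last_pos₀
  | succ k =>
    have h1 := h.succ_last k
    have h2 := h.len_pos k
    have : n * 2 ^ (k + 1) - 1 = n * 2 ^ k + (n * 2 ^ k - 1) := by
      rw [pow_succ, ← mul_assoc]; omega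
    rw [this, h1]; omega

theorem le_of_lt (h : IsTower m n C) (k : ℕ) : ∀ i < n * 2 ^ k, C i ≤ m := by
  induction k with
  | zero => simpa using h.le₀
  | succ k ih =>
    intro i hi
    rcases lt_or_ge i (n * 2 ^ k) with h1 | h1
    · exact ih i h1
    · obtain ⟨j, rfl⟩ := Nat.exists_eq_add_of_le h1
      rw [pow_succ, ← mul_assoc] at hi
      rw [h.succ k j (by omega)]
      split_ifs with h2
      · have h3 := h.last_pos k
        rw [← h2, Nat.add_sub_cancel] at h3
        have := ih j (by omega)
        omega
      · omega

theorem le (h : IsTower m n C) (i : ℕ) : C i ≤ m :=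
  h.le_of_lt i i (by
    have h1 : i < 2 ^ i := Nat.lt_two_pow_self
    have := h.pos
    nlinarith)

theorem admissible (h : IsTower m n C) (k : ℕ) : Admissible m (n * 2 ^ k) C := by
  induction k with
  | zero => simpa using h.admissible₀
  | succ k ih =>
    rw [pow_succ, ← mul_assoc]
    exact ih.double (h.len_pos k) (h.le_of_lt k) h.reflect_lt (h.last_pos k) (h.succ k)

theorem len_mono (n : ℕ) {k l : ℕ} (hkl : k ≤ l) : n * 2 ^ k ≤ n * 2 ^ l :=
  Nat.mul_le_mul_left _ (Nat.pow_le_pow_right (by norm_num) hkl)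

/-- The proper tails of a sequence that starts with `c_k` and continues with its reflection. -/
theorem shift_ltUpTo (h : IsTower m n C) {k K : ℕ} {t : ℕ → ℕ}
    (ht : Agree (n * 2 ^ k) t C) (ht' : Agree (n * 2 ^ k) (reflectSeq m (shift (n * 2 ^ k) t)) C)
    (htm : ∀ i, t i ≤ m) (hK0 : 0 < K) (hK : K < n * 2 ^ k) :
    LtUpTo (n * 2 ^ k) (shift K t) C := by
  set N := n * 2 ^ k
  obtain ⟨hu, -⟩ := h.admissible k K hK0 hK
  rcases ltUpTo_trichotomy (N - K) C (shift K C) with h1 | h1 | h1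
  · exact absurd h1 hu
  -- The suffix of c_k equals a prefix, so the reflected copy of c_k is now compared with C from
  -- position `N - K`; the strict reflected bound there decides.
  · obtain ⟨f, hf, hfag, hflt⟩ := (h.admissible k (N - K) (by omega) (by omega)).2
    have hC := h.le
    refine ⟨N - K + f, by omega, fun i hi => ?_, ?_⟩
    · rcases lt_or_ge i (N - K) with h2 | h2
      · have := h1 i h2
        have := ht (K + i) (by omega)
        simp only [shift] at *
        omega
      · obtain ⟨e, rfl⟩ := Nat.exists_eq_add_of_le h2
        have h3 := hfag e (by omega)
        have h4 := ht' e (by omega)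
        have h5 : K + (N - K + e) = N + e := by omega
        have := hC (N - K + e)
        have := hC e
        have := htm (N + e)
        simp only [shift, reflectSeq] at *
        rw [h5]
        omega
    · have h4 := ht' f (by omega)
      have h5 : K + (N - K + f) = N + f := by omega
      have := hC (N - K + f)
      have := hC f
      have := htm (N + f)
      simp only [shift, reflectSeq] at *
      rw [h5]
      omega
  · refine (h1.congr (fun i hi => ?_) fun i hi => rfl).mono (by omega)
    exact (ht (K + i) (by omega)).symm

/-- The reflected bounds are strict, so the comparison is settled before c_k ends and the
continuation of `t` plays no role. -/
theorem reflect_shift_ltUpTo (h : IsTower m n C) {k K : ℕ} {t : ℕ → ℕ}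
    (ht : Agree (n * 2 ^ k) t C) (hK : K < n * 2 ^ k) :
    LtUpTo (n * 2 ^ k) (reflectSeq m (shift K t)) C := by
  rcases Nat.eq_zero_or_pos K with rfl | hK0
  · refine ⟨0, hK, by simp, ?_⟩
    have := ht 0 hK
    simp only [shift, reflectSeq, add_zero, this]
    exact h.reflect_lt
  · obtain ⟨-, hl⟩ := h.admissible k K hK0 hK
    refine (hl.congr (fun i hi => ?_) fun i hi => rfl).mono (by omega)
    simp only [shift, reflectSeq]
    rw [ht (K + i) (by omega)]

/-- A sequence that starts with `c_k` and continues with its reflection is below `c_{k+1}`. -/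
theorem ltUpTo_succ (h : IsTower m n C) {k : ℕ} {t : ℕ → ℕ}
    (ht : Agree (n * 2 ^ k) t C) (ht' : Agree (n * 2 ^ k) (reflectSeq m (shift (n * 2 ^ k) t)) C)
    (htm : ∀ i, t i ≤ m) : LtUpTo (n * 2 ^ (k + 1)) t C := by
  have hN := h.len_pos k
  have hC := h.le
  have hs := h.succ_last k
  have hs' := fun i => h.succ_lt (k := k) (i := i)
  rw [pow_succ, ← mul_assoc]
  set N := n * 2 ^ k
  simp only [Agree, shift, reflectSeq] at ht'
  refine ⟨N + (N - 1), by omega, fun i hi => ?_, ?_⟩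
  · rcases lt_or_ge i N with h1 | h1
    · exact ht i h1
    · obtain ⟨e, rfl⟩ := Nat.exists_eq_add_of_le h1
      have := ht' e (by omega)
      have := htm (N + e)
      rw [hs' e (by omega)]
      omega
  · have := ht' (N - 1) (by omega)
    have := htm (N + (N - 1))
    omega

/-- All tails of `t` and of its reflection are below `c_ℓ`. -/
def TailsBelow (m n : ℕ) (C : ℕ → ℕ) (l : ℕ) (t : ℕ → ℕ) : Prop :=
  ∀ K, LtUpTo (n * 2 ^ l) (shift K t) C ∧ LtUpTo (n * 2 ^ l) (reflectSeq m (shift K t)) C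

/-- Only `K = 0` needs the length of c_{k+1}, hence `k < l`; the other tails are decided within the
length of c_k. -/
theorem tails_below_aux (h : IsTower m n C) {k l K : ℕ} (hkl : k < l) {t : ℕ → ℕ}
    (ht : Agree (n * 2 ^ k) t C) (ht' : Agree (n * 2 ^ k) (reflectSeq m (shift (n * 2 ^ k) t)) C)
    (htm : ∀ i, t i ≤ m) (hK : K < n * 2 ^ k) :
    LtUpTo (n * 2 ^ l) (shift K t) C ∧ LtUpTo (n * 2 ^ l) (reflectSeq m (shift K t)) C := by
  refine ⟨?_, (h.reflect_shift_ltUpTo ht hK).mono (len_mono n hkl.le)⟩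
  rcases Nat.eq_zero_or_pos K with rfl | hK0
  · rw [shift_zero]
    exact (h.ltUpTo_succ ht ht' htm).mono (len_mono n hkl)
  · exact (h.shift_ltUpTo ht ht' htm hK0 hK).mono (len_mono n hkl.le)

/-- Tails starting inside c_k are handled by `tails_below_aux`. Later ones are tails of the
remainder, and the pair of bounds is invariant under reflection. -/
theorem tailsBelow_cons (h : IsTower m n C) {k l : ℕ} (hkl : k < l) {t : ℕ → ℕ}
    (ht : Agree (n * 2 ^ k) t C) (ht' : Agree (n * 2 ^ k) (reflectSeq m (shift (n * 2 ^ k) t)) C)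
    (htm : ∀ i, t i ≤ m)
    (hB : TailsBelow m n C l (reflectSeq m (shift (n * 2 ^ k) t))) : TailsBelow m n C l t := by
  intro K
  rcases lt_or_ge K (n * 2 ^ k) with hK | hK
  · exact h.tails_below_aux hkl ht ht' htm hK
  · obtain ⟨e, rfl⟩ := Nat.exists_eq_add_of_le hK
    have := hB e
    rw [shift_reflectSeq, shift_shift,
      reflectSeq_reflectSeq (s := shift _ t) fun i => htm _] at this
    exact this.symm

theorem tailsBelow_periodic (h : IsTower m n C) {k l : ℕ} (hkl : k < l) {t : ℕ → ℕ}
    (ht : Agree (n * 2 ^ k) t C) (ht' : reflectSeq m (shift (n * 2 ^ k) t) = t)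
    (htm : ∀ i, t i ≤ m) : TailsBelow m n C l t := by
  intro K
  induction K using Nat.strong_induction_on with
  | _ K ih =>
    rcases lt_or_ge K (n * 2 ^ k) with hK | hK
    · exact h.tails_below_aux hkl ht (by rwa [ht']) htm hK
    · obtain ⟨e, rfl⟩ := Nat.exists_eq_add_of_le hK
      have h1 := ih e (by have := h.len_pos k; omega)
      have h2 : shift (n * 2 ^ k + e) t = reflectSeq m (shift e t) := by
        have h3 : shift (n * 2 ^ k) t = reflectSeq m t := by
          conv_rhs => rw [← ht', reflectSeq_reflectSeq (s := shift _ t) fun i => htm _]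
        rw [← shift_shift, h3, shift_reflectSeq]
      rw [h2, reflectSeq_reflectSeq (s := shift _ _) fun i => htm _]
      exact h1.symm

/-- Removing c_k and reflecting leaves `t` unchanged, which reduces everything to tails starting
inside c_k. This domination makes (c_ℓ c̄_ℓ)^∞ usable in `one_le_val`. -/
theorem shift_le_of_periodic (h : IsTower m n C) {k : ℕ} {t : ℕ → ℕ}
    (ht : Agree (n * 2 ^ k) t C) (ht' : reflectSeq m (shift (n * 2 ^ k) t) = t)
    (htm : ∀ i, t i ≤ m) (K : ℕ) :
    toLex (shift K t) ≤ toLex t ∧ toLex (reflectSeq m (shift K t)) ≤ toLex t := by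
  induction K using Nat.strong_induction_on with
  | _ K ih =>
    rcases lt_or_ge K (n * 2 ^ k) with hK | hK
    · refine ⟨?_, ((h.reflect_shift_ltUpTo ht hK).congr (fun i hi => rfl) ht.symm).lex_lt.le⟩
      rcases Nat.eq_zero_or_pos K with rfl | hK0
      · rw [shift_zero]
      · exact ((h.shift_ltUpTo ht (by rwa [ht']) htm hK0 hK).congr
          (fun i hi => rfl) ht.symm).lex_lt.le
    · obtain ⟨e, rfl⟩ := Nat.exists_eq_add_of_le hK
      have h1 := ih e (by have := h.len_pos k; omega)
      have h2 : shift (n * 2 ^ k + e) t = reflectSeq m (shift e t) := by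
        have h3 : shift (n * 2 ^ k) t = reflectSeq m t := by
          conv_rhs => rw [← ht', reflectSeq_reflectSeq (s := shift _ t) fun i => htm _]
        rw [← shift_shift, h3, shift_reflectSeq]
      rw [h2, reflectSeq_reflectSeq (s := shift _ _) fun i => htm _]
      exact h1.symm

/-- All tails of `t` and of its reflection are below `g`. -/
def TailsLt (m : ℕ) (g t : ℕ → ℕ) : Prop :=
  ∀ K, toLex (shift K t) < toLex g ∧ toLex (reflectSeq m (shift K t)) < toLex g

theorem TailsLt.shift {g t : ℕ → ℕ} (h : TailsLt m g t) (k : ℕ) :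
    TailsLt m g (shift k t) := fun K => by
  rw [shift_shift]; exact h _

theorem TailsLt.reflectSeq {g t : ℕ → ℕ} (h : TailsLt m g t) (htm : ∀ i, t i ≤ m) :
    TailsLt m g (reflectSeq m t) := fun K => by
  rw [shift_reflectSeq, reflectSeq_reflectSeq (s := UniqueExpansion.shift _ _) fun i => htm _]
  exact (h K).symm

/-- A sequence that starts with `c_k` either starts with `c_{k+1}` or continues with the
reflection of `c_k`. -/
theorem agree_succ_or (h : IsTower m n C) {k l : ℕ} {g t : ℕ → ℕ} (hkl : k < l)
    (hg : Agree (n * 2 ^ l) g C) (htm : ∀ i, t i ≤ m) (hB : TailsLt m g t)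
    (ht : Agree (n * 2 ^ k) t C) :
    Agree (n * 2 ^ (k + 1)) t C ∨ Agree (n * 2 ^ k) (reflectSeq m (shift (n * 2 ^ k) t)) C := by
  have hN := h.len_pos k
  have hC := h.le
  have hNl : n * 2 ^ k * 2 ≤ n * 2 ^ l := by
    rw [mul_assoc, ← pow_succ]; exact len_mono n hkl
  have hs := h.succ_last k
  have hs' := fun i => h.succ_lt (k := k) (i := i)
  rw [pow_succ, ← mul_assoc]
  set N := n * 2 ^ k
  -- `hu` and `hl` squeeze the N digits after c_k between c̄_k and c̄_k⁺, and no word of the same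
  -- length lies strictly between w and w⁺.
  have hu : ¬ LtUpTo (N * 2) C t := fun h1 =>
    not_ltUpTo_of_lex_le (by simpa [shift_zero] using (hB 0).1.le)
      (h1.congr (fun i hi => (hg i (by omega)).symm) fun i hi => rfl)
  have hl : ¬ LtUpTo N C (reflectSeq m (shift N t)) := fun h1 =>
    not_ltUpTo_of_lex_le (hB N).2.le
      (h1.congr (fun i hi => (hg i (by omega)).symm) fun i hi => rfl)
  rcases ltUpTo_trichotomy N (reflectSeq m (shift N t)) C with ⟨d, hd, hag, hlt⟩ | h1 | h1
  · left
    have hx : ∀ e, t (N + e) ≤ m := fun e => htm _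
    have hd' : d = N - 1 := by
      by_contra hne
      refine hu ⟨N + d, by omega, fun i hi => ?_, ?_⟩
      · rcases lt_or_ge i N with h1 | h1
        · exact (ht i h1).symm
        · obtain ⟨e, rfl⟩ := Nat.exists_eq_add_of_le h1
          have := hag e (by omega)
          have := hx e
          simp only [shift, reflectSeq] at *
          rw [hs' e (by omega)]
          omega
      · have := hx d
        have := hC d
        simp only [shift, reflectSeq] at *
        rw [hs' d (by omega)]
        omega
    subst hd'
    have hpre : ∀ i < N + (N - 1), t i = C i := fun i hi => by
      rcases lt_or_ge i N with h1 | h1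
      · exact ht i h1
      · obtain ⟨e, rfl⟩ := Nat.exists_eq_add_of_le h1
        have := hag e (by omega)
        have := hx e
        simp only [shift, reflectSeq] at *
        rw [hs' e (by omega)]
        omega
    intro i hi
    rcases lt_or_ge i (N + (N - 1)) with h1 | h1
    · exact hpre i h1
    · obtain rfl : i = N + (N - 1) := by omega
      by_contra hne
      refine hu ⟨N + (N - 1), by omega, fun i hi => (hpre i hi).symm, ?_⟩
      have := hx (N - 1)
      have := hC (N - 1)
      simp only [shift, reflectSeq] at *
      omega
  · exact Or.inr h1
  · exact absurd h1 hl

/-- Below the periodic continuation `g` of `c_ℓ` and its reflection, no tail starts with `c_ℓ`. -/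
theorem not_agree_top (h : IsTower m n C) {l : ℕ} {g t : ℕ → ℕ}
    (hg : Agree (n * 2 ^ l) g C) (hg' : reflectSeq m (shift (n * 2 ^ l) g) = g)
    (hgm : ∀ i, g i ≤ m) (hB : TailsLt m g t)
    (ht : Agree (n * 2 ^ l) t C) : False := by
  have hN := h.len_pos l
  set N := n * 2 ^ l
  obtain ⟨d, hag, hlt⟩ := lex_lt_iff.mp (hB 0).1
  rw [shift_zero] at hag hlt
  have hdN : N ≤ d := by
    by_contra hdN
    have h1 := ht d (by omega)
    have h2 := hg d (by omega)
    omega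
  obtain ⟨e, rfl⟩ := Nat.exists_eq_add_of_le hdN
  -- Cancelling the common prefix c_ℓ from `t < g` leaves a remainder below the reflection of `g`;
  -- reflecting reverses this.
  have h1 : toLex g < toLex (reflectSeq m (shift N t)) := by
    rw [← hg']
    refine lex_lt_iff.mpr ⟨e, fun i hi => ?_, ?_⟩
    · have := hag (N + i) (by omega)
      simp only [shift, reflectSeq]
      rw [this]
    · have := hgm (N + e)
      simp only [shift, reflectSeq]
      omega
  exact absurd (hB N).2 (not_lt.mpr h1.le)

/-- The longest `c_k` with which `t` starts is followed by its reflection. -/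
theorem exists_agree_reflect (h : IsTower m n C) {k l : ℕ} {g t : ℕ → ℕ} (hkl : k < l)
    (hg : Agree (n * 2 ^ l) g C) (hg' : reflectSeq m (shift (n * 2 ^ l) g) = g)
    (hgm : ∀ i, g i ≤ m) (htm : ∀ i, t i ≤ m) (hB : TailsLt m g t)
    (ht : Agree (n * 2 ^ k) t C) :
    ∃ k', k ≤ k' ∧ k' < l ∧ Agree (n * 2 ^ k') t C ∧
      Agree (n * 2 ^ k') (reflectSeq m (shift (n * 2 ^ k') t)) C := by
  induction hd : l - k generalizing k with
  | zero => omega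
  | succ d ih =>
    rcases h.agree_succ_or hkl hg htm hB ht with h1 | h1
    · rcases Nat.lt_or_ge (k + 1) l with h2 | h2
      · obtain ⟨k', h3, h4⟩ := ih h2 h1 (by omega)
        exact ⟨k', by omega, h4⟩
      · obtain rfl : l = k + 1 := by omega
        exact (h.not_agree_top hg hg' hgm hB h1).elim
    · exact ⟨k, le_rfl, hkl, ht, h1⟩

end IsTower

/-! ### Values of digit sequences -/

/-- The number `s₀ q⁻¹ + s₁ q⁻² + ⋯`. -/
noncomputable def val (q : ℝ) (s : ℕ → ℕ) : ℝ := ∑' i, (s i : ℝ) / q ^ (i + 1)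

section Val

variable {m : ℕ} {q : ℝ} {s t : ℕ → ℕ}

theorem hasSum_const_digit (hq : 1 < q) (m : ℕ) :
    HasSum (fun i : ℕ => (m : ℝ) / q ^ (i + 1)) (m / (q - 1)) := by
  have h1 : HasSum (fun i : ℕ => (q⁻¹) ^ i) (1 - q⁻¹)⁻¹ :=
    hasSum_geometric_of_lt_one (by positivity) (inv_lt_one_of_one_lt₀ hq)
  have h2 := h1.mul_left ((m : ℝ) / q)
  have hq0 : q ≠ 0 := by positivity
  have hq1 : q - 1 ≠ 0 := by linarith
  have e1 : (m : ℝ) / q * (1 - q⁻¹)⁻¹ = m / (q - 1) := by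
    have : 1 - q⁻¹ = (q - 1) / q := by field_simp
    rw [this]
    field_simp
  have e2 : (fun i : ℕ => (m : ℝ) / q ^ (i + 1)) = fun i => (m : ℝ) / q * (q⁻¹) ^ i := by
    funext i
    rw [pow_succ, inv_pow, div_mul_eq_div_div_swap, div_eq_mul_inv (_ / q)]
  rw [e2, ← e1]
  exact h2

theorem summable_digits (hq : 1 < q) (hs : ∀ i, s i ≤ m) :
    Summable (fun i => (s i : ℝ) / q ^ (i + 1)) := by
  refine Summable.of_nonneg_of_le (fun i => by positivity) (fun i => ?_)
    (hasSum_const_digit hq m).summable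
  have : (s i : ℝ) ≤ m := by exact_mod_cast hs i
  gcongr

theorem isExpansion_iff (hq : 1 < q) {x : ℝ} :
    IsExpansion m q x s ↔ (∀ i, s i ≤ m) ∧ val q s = x := by
  constructor
  · rintro ⟨h1, h2⟩
    exact ⟨h1, h2.tsum_eq⟩
  · rintro ⟨h1, rfl⟩
    exact ⟨h1, (summable_digits hq h1).hasSum⟩

theorem val_nonneg (hq : 1 < q) : 0 ≤ val q s := tsum_nonneg fun i => by positivity

theorem val_le (hq : 1 < q) (hs : ∀ i, s i ≤ m) : val q s ≤ m / (q - 1) := by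
  rw [← (hasSum_const_digit hq m).tsum_eq]
  refine (summable_digits hq hs).tsum_le_tsum (fun i => ?_) (hasSum_const_digit hq m).summable
  have : (s i : ℝ) ≤ m := by exact_mod_cast hs i
  gcongr

theorem val_reflect (hq : 1 < q) (hs : ∀ i, s i ≤ m) :
    val q (reflectSeq m s) = m / (q - 1) - val q s := by
  have h := (hasSum_const_digit hq m).sub (summable_digits hq hs).hasSum
  rw [val, val, ← h.tsum_eq]
  congr 1
  funext i
  rw [reflectSeq, Nat.cast_sub (hs i)]
  ring

theorem val_split (hq : 1 < q) (hs : ∀ i, s i ≤ m) (k : ℕ) :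
    val q s = ∑ i ∈ Finset.range k, (s i : ℝ) / q ^ (i + 1) + val q (shift k s) / q ^ k := by
  rw [val, ← (summable_digits hq hs).sum_add_tsum_nat_add k, val, ← tsum_div_const]
  congr 2
  funext i
  rw [shift, add_comm k i, div_div]
  congr 1
  ring

theorem val_head (hq : 1 < q) (hs : ∀ i, s i ≤ m) :
    val q s * q = s 0 + val q (shift 1 s) := by
  rw [val_split hq hs 1]
  have : q ≠ 0 := by positivity
  simp
  field_simp

/-- The comparison of values after a common prefix. -/
theorem val_sub_mul (hq : 1 < q) (hs : ∀ i, s i ≤ m) (ht : ∀ i, t i ≤ m) {d : ℕ}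
    (h : ∀ i < d, s i = t i) :
    (val q s - val q t) * q ^ (d + 1) =
      s d - t d + (val q (shift (d + 1) s) - val q (shift (d + 1) t)) := by
  rw [val_split hq hs (d + 1), val_split hq ht (d + 1), Finset.sum_range_succ,
    Finset.sum_range_succ, Finset.sum_congr rfl fun i hi => by rw [h i (Finset.mem_range.mp hi)]]
  have : q ≠ 0 := by positivity
  field_simp
  ring

theorem val_pos (hq : 1 < q) (hs : ∀ i, s i ≤ m) {i : ℕ} (hi : 0 < s i) : 0 < val q s :=
  (summable_digits hq hs).tsum_pos (fun i => by positivity) i (by positivity)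

theorem val_mono_base {q' : ℝ} (hq : 1 < q) (hqq : q ≤ q') (hs : ∀ i, s i ≤ m) :
    val q' s ≤ val q s := by
  refine (summable_digits (hq.trans_le hqq) hs).tsum_le_tsum (fun i => ?_) (summable_digits hq hs)
  gcongr

theorem val_lt_of_base_lt {q' : ℝ} (hq : 1 < q) (hqq : q < q') (hs : ∀ i, s i ≤ m) {i : ℕ}
    (hi : 0 < s i) : val q' s < val q s := by
  refine (summable_digits (hq.trans hqq) hs).tsum_lt_tsum (i := i) (fun i => ?_) ?_
    (summable_digits hq hs)
  · have := hqq.le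
    gcongr
  · have : (0 : ℝ) < s i := by exact_mod_cast hi
    gcongr

/-! ### Existence of expansions -/

/-- The remainders of the quasi-greedy algorithm. -/
noncomputable def quasiGreedyRem (m : ℕ) (q y : ℝ) : ℕ → ℝ
  | 0 => y
  | k + 1 => q * quasiGreedyRem m q y k - (min m (⌈q * quasiGreedyRem m q y k⌉₊ - 1) : ℕ)

/-- The digit ⌈q r⌉ - 1 keeps a positive remainder positive, which prevents a last nonzero digit.
The condition `q ≤ m + 1` says 1 ≤ m/(q-1), so a remainder after a digit below m, being at most 1,
stays in range. For remainder 0 the truncated subtraction gives the digit 0. -/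
theorem exists_expansion (hq : 1 < q) (hqm : q ≤ m + 1) {y : ℝ} (hy0 : 0 ≤ y)
    (hy : y ≤ m / (q - 1)) :
    ∃ c : ℕ → ℕ, (∀ i, c i ≤ m) ∧ IsInfiniteSeq c ∧ val q c = y := by
  set r := quasiGreedyRem m q y with hr
  set c : ℕ → ℕ := fun k => min m (⌈q * r k⌉₊ - 1) with hc
  have hq1 : 0 < q - 1 := by linarith
  have hq0 : 0 < q := by linarith
  have hrs : ∀ k, r (k + 1) = q * r k - c k := fun k => rfl
  have hm1 : 1 ≤ (m : ℝ) / (q - 1) := by rw [le_div_iff₀ hq1]; linarith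
  have hcm : ∀ i, c i ≤ m := fun i => min_le_left _ _
  have hstep0 : ∀ k, r k = 0 → c k = 0 := fun k h => by simp [hc, h]
  have hceil : ∀ x : ℝ, 0 < x → ((⌈x⌉₊ - 1 : ℕ) : ℝ) < x := fun x hx => by
    have h1 : 0 < ⌈x⌉₊ := Nat.ceil_pos.mpr hx
    exact Nat.lt_ceil.mp (by omega)
  have hpos : ∀ k, 0 < r k → 0 < r (k + 1) := fun k h => by
    have h1 := hceil (q * r k) (by positivity)
    have h2 : (c k : ℝ) ≤ ((⌈q * r k⌉₊ - 1 : ℕ) : ℝ) := by exact_mod_cast min_le_right _ _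
    rw [hrs]; linarith
  have hzero : ∀ k, r k = 0 → r (k + 1) = 0 := fun k h => by
    rw [hrs, hstep0 k h, h]; simp
  have hbd : ∀ k, 0 ≤ r k ∧ r k ≤ m / (q - 1) := by
    intro k
    induction k with
    | zero => exact ⟨hy0, hy⟩
    | succ k ih =>
      rcases ih.1.eq_or_lt with h | h
      · rw [hzero k h.symm]; exact ⟨le_rfl, by linarith⟩
      · refine ⟨(hpos k h).le, ?_⟩
        rw [hrs]
        rcases le_total m (⌈q * r k⌉₊ - 1) with h1 | h1
        · have : c k = m := min_eq_left h1
          rw [this]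
          have h2 : q * r k ≤ q * (m / (q - 1)) := by gcongr; exact ih.2
          have h3 : q * ((m : ℝ) / (q - 1)) - m = m / (q - 1) := by field_simp; ring
          linarith
        · have : c k = ⌈q * r k⌉₊ - 1 := min_eq_right h1
          rw [this]
          have h2 : q * r k ≤ ⌈q * r k⌉₊ := Nat.le_ceil _
          have h3 : 0 < ⌈q * r k⌉₊ := Nat.ceil_pos.mpr (by positivity)
          have h4 : (((⌈q * r k⌉₊ - 1 : ℕ)) : ℝ) = ⌈q * r k⌉₊ - 1 := by
            rw [Nat.cast_sub h3]; simp
          linarith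
  have hsum : ∀ k, ∑ i ∈ Finset.range k, (c i : ℝ) / q ^ (i + 1) = y - r k / q ^ k := by
    intro k
    induction k with
    | zero => simp [hr, quasiGreedyRem]
    | succ k ih =>
      rw [Finset.sum_range_succ, ih, hrs]
      field_simp
      ring
  have hlim : Filter.Tendsto (fun k => r k / q ^ k) Filter.atTop (nhds 0) := by
    have h1 : Filter.Tendsto (fun k : ℕ => (m : ℝ) / (q - 1) * (q⁻¹) ^ k) Filter.atTop
        (nhds 0) := by
      simpa using (tendsto_pow_atTop_nhds_zero_of_lt_one (by positivity : (0 : ℝ) ≤ q⁻¹)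
        (inv_lt_one_of_one_lt₀ hq)).const_mul ((m : ℝ) / (q - 1))
    refine squeeze_zero (fun k => div_nonneg (hbd k).1 (by positivity)) (fun k => ?_) h1
    rw [inv_pow, ← div_eq_mul_inv]
    gcongr
    exact (hbd k).2
  have hval : val q c = y := by
    have h1 := (summable_digits hq hcm).hasSum.tendsto_sum_nat
    have h2 : Filter.Tendsto (fun k => ∑ i ∈ Finset.range k, (c i : ℝ) / q ^ (i + 1))
        Filter.atTop (nhds y) := by
      simp_rw [hsum]
      simpa using hlim.const_sub y
    exact tendsto_nhds_unique h1 h2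
  refine ⟨c, hcm, ?_, hval⟩
  rintro ⟨N, hN, hN'⟩
  have h1 : ∀ k ≤ N, 0 < r k := by
    intro k hk
    by_contra h
    have h0 : r k = 0 := le_antisymm (not_lt.mp h) (hbd k).1
    have : ∀ j, r (k + j) = 0 := fun j => by
      induction j with
      | zero => exact h0
      | succ j ih => exact hzero _ ih
    have h2 := this (N - k)
    rw [Nat.add_sub_cancel' hk] at h2
    exact hN (hstep0 _ h2)
  -- After a last nonzero digit, r_k / q^k would be a positive constant, although it tends to 0.
  have h2 : ∀ j, r (N + 1 + j) = q ^ j * r (N + 1) := fun j => by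
    induction j with
    | zero => simp
    | succ j ih =>
      rw [← add_assoc, hrs, hN' (N + 1 + j) (by omega), ih]
      simp; ring
  have h3 : ∀ j, r (N + 1) / q ^ (N + 1) = r (N + 1 + j) / q ^ (N + 1 + j) := fun j => by
    rw [h2, pow_add q (N + 1) j]; field_simp
  have h4 : Filter.Tendsto (fun j => r (N + 1 + j) / q ^ (N + 1 + j)) Filter.atTop (nhds 0) := by
    have := hlim.comp (Filter.tendsto_add_atTop_nat (N + 1))
    refine this.congr fun j => ?_
    simp [add_comm j]
  have h5 : r (N + 1) / q ^ (N + 1) = 0 :=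
    tendsto_nhds_unique (tendsto_const_nhds.congr h3) h4
  have := hpos N (h1 N le_rfl)
  have : 0 < r (N + 1) / q ^ (N + 1) := by positivity
  linarith

/-- The sequence `s₀ ⋯ s_{k-1} (s_k + 1) c₀ c₁ ⋯`. -/
def raise (s : ℕ → ℕ) (k : ℕ) (c : ℕ → ℕ) : ℕ → ℕ :=
  fun i => if i < k then s i else if i = k then s k + 1 else c (i - (k + 1))

theorem raise_of_lt {k i : ℕ} {c : ℕ → ℕ} (hi : i < k) : raise s k c i = s i := if_pos hi

theorem raise_self {k : ℕ} {c : ℕ → ℕ} : raise s k c k = s k + 1 := by simp [raise]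

theorem shift_raise {k : ℕ} {c : ℕ → ℕ} : shift (k + 1) (raise s k c) = c := by
  funext i
  simp only [shift, raise]
  rw [if_neg (by omega), if_neg (by omega)]
  congr 1
  omega

theorem raise_le {k : ℕ} {c : ℕ → ℕ} (hs : ∀ i, s i ≤ m) (hk : s k < m) (hc : ∀ i, c i ≤ m)
    (i : ℕ) : raise s k c i ≤ m := by
  simp only [raise]
  split_ifs
  exacts [hs i, hk, hc _]

theorem val_raise {k : ℕ} {c : ℕ → ℕ} (hq : 1 < q) (hs : ∀ i, s i ≤ m) (hk : s k < m)
    (hc : ∀ i, c i ≤ m) (h : val q c = val q (shift (k + 1) s) - 1) :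
    val q (raise s k c) = val q s := by
  have h1 := val_sub_mul hq (raise_le hs hk hc) hs (d := k) fun i hi => raise_of_lt hi
  rw [shift_raise, raise_self, h] at h1
  have h2 : (val q (raise s k c) - val q s) * q ^ (k + 1) = 0 := by
    rw [h1]; push_cast; ring
  have h3 : q ^ (k + 1) ≠ 0 := by positivity
  have := (mul_eq_zero.mp h2).resolve_right h3
  linarith

/-! ### The characterization of unique expansions -/

/-- The conditions on the values of the tails that characterize unique expansions. -/
def IsUnivoque (m : ℕ) (q : ℝ) (b : ℕ → ℕ) : Prop :=
  (∀ i, b i ≤ m) ∧ ∀ i, (b i < m → val q (shift (i + 1) b) < 1) ∧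
    (0 < b i → val q (reflectSeq m (shift (i + 1) b)) < 1)

theorem IsUnivoque.reflect {b : ℕ → ℕ} (h : IsUnivoque m q b) :
    IsUnivoque m q (reflectSeq m b) := by
  refine ⟨reflectSeq_le m b, fun i => ⟨fun hi => ?_, fun hi => ?_⟩⟩
  · rw [shift_reflectSeq]
    exact (h.2 i).2 (by simp only [reflectSeq] at hi; omega)
  · rw [shift_reflectSeq, reflectSeq_reflectSeq (s := shift _ b) fun i => h.1 _]
    exact (h.2 i).1 (by simp only [reflectSeq] at hi; omega)

/-- If `c` is first larger than `b` at `d`, equality of values forces the tail of `b` after `d` to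
be worth at least 1, although `b d < m`. Reflection covers the other case. -/
theorem IsUnivoque.eq_of_val_eq {b c : ℕ → ℕ} (hq : 1 < q) (h : IsUnivoque m q b)
    (hc : ∀ i, c i ≤ m) (hv : val q c = val q b) : c = b := by
  have key : ∀ {b c : ℕ → ℕ}, IsUnivoque m q b → (∀ i, c i ≤ m) → val q c = val q b →
      ¬ toLex b < toLex c := by
    intro b c h hc hv hlt
    obtain ⟨d, hag, hlt⟩ := lex_lt_iff.mp hlt
    have h1 := val_sub_mul hq hc h.1 (d := d) fun i hi => (hag i hi).symm
    rw [hv, sub_self, zero_mul] at h1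
    have h2 := (h.2 d).1 (hlt.trans_le (hc d))
    have h3 : (b d : ℝ) + 1 ≤ c d := by exact_mod_cast hlt
    have h4 := val_nonneg (s := shift (d + 1) c) hq
    linarith
  rcases lt_trichotomy (toLex c) (toLex b) with h1 | h1 | h1
  · refine (key h.reflect (reflectSeq_le m c) ?_ ?_).elim
    · rw [val_reflect hq hc, val_reflect hq h.1, hv]
    · obtain ⟨d, hag, hlt⟩ := lex_lt_iff.mp h1
      refine lex_lt_iff.mpr ⟨d, fun i hi => ?_, ?_⟩
      · simp only [reflectSeq, hag i hi]
      · have := h.1 d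
        simp only [reflectSeq]; omega
  · exact toLex.injective h1
  · exact (key h hc hv h1).elim

/-- If a tail after a digit below m is worth at least 1, raise that digit and expand the tail minus
1 instead: this is a second expansion. Reflection gives the other condition. -/
theorem mem_univoqueSeqs_iff (hq : 1 < q) (hqm : q ≤ m + 1) {b : ℕ → ℕ} :
    b ∈ univoqueSeqs m q ↔ IsUnivoque m q b := by
  constructor
  · rintro ⟨x, ⟨-, c, -, hc⟩, hb⟩
    have huniq : ∀ d, (∀ i, d i ≤ m) → val q d = val q b → d = b := fun d hd hv => by
      rw [hc b hb]
      refine hc d ((isExpansion_iff hq).mpr ⟨hd, ?_⟩)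
      rw [hv]; exact ((isExpansion_iff hq).mp hb).2
    have hbm := hb.1
    have key : ∀ b : ℕ → ℕ, (∀ i, b i ≤ m) →
        (∀ d, (∀ i, d i ≤ m) → val q d = val q b → d = b) →
        ∀ i, b i < m → val q (shift (i + 1) b) < 1 := by
      intro b hbm huniq i hi
      by_contra h1
      have h2 := val_le (s := shift (i + 1) b) hq fun i => hbm _
      obtain ⟨c, hcm, -, hcv⟩ := exists_expansion (m := m) hq hqm
        (y := val q (shift (i + 1) b) - 1) (by linarith) (by linarith)
      have h3 := huniq _ (raise_le hbm hi hcm) (val_raise hq hbm hi hcm hcv)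
      have h4 := congrFun h3 i
      rw [raise_self] at h4
      omega
    refine ⟨hbm, fun i => ⟨key b hbm huniq i, fun hi => ?_⟩⟩
    refine key (reflectSeq m b) (reflectSeq_le m b) (fun d hd hv => ?_) i ?_
    · have := huniq (reflectSeq m d) (reflectSeq_le m d) (by
        rw [val_reflect hq hd, hv, val_reflect hq hbm]; ring)
      rw [← this, reflectSeq_reflectSeq hd]
    · have := hbm i
      simp only [reflectSeq]; omega
  · intro h
    have hb : IsExpansion m q (val q b) b := (isExpansion_iff hq).mpr ⟨h.1, rfl⟩
    refine ⟨val q b, ⟨⟨val_nonneg hq, val_le hq h.1⟩, b, hb, fun c hc => ?_⟩, hb⟩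
    obtain ⟨h1, h2⟩ := (isExpansion_iff hq).mp hc
    exact h.eq_of_val_eq hq h1 h2

theorem IsUnivoque.mono_base {q' : ℝ} {b : ℕ → ℕ} (hq : 1 < q) (hqq : q ≤ q')
    (h : IsUnivoque m q b) : IsUnivoque m q' b :=
  ⟨h.1, fun i => ⟨fun hi => (val_mono_base hq hqq fun _ => h.1 _).trans_lt ((h.2 i).1 hi),
    fun hi => (val_mono_base hq hqq (reflectSeq_le m _)).trans_lt ((h.2 i).2 hi)⟩⟩

/-! ### Lexicographic bounds and bounds on values -/

/-- At the first difference from `g` the excess over 1 passes to a later tail, divided by at least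
q. That tail again follows a digit below m, so the argument repeats, and n rounds bound the excess
by q⁻ⁿ m/(q-1). -/
theorem val_shift_le_one {b g : ℕ → ℕ} (hq : 1 < q) (hb : ∀ i, b i ≤ m) (hg : ∀ i, g i ≤ m)
    (hv : val q g ≤ 1) (h : ∀ i, b i < m → toLex (shift (i + 1) b) ≤ toLex g) {K : ℕ}
    (hK : toLex (shift K b) ≤ toLex g) : val q (shift K b) ≤ 1 := by
  have hM : 0 ≤ (m : ℝ) / (q - 1) := div_nonneg (by positivity) (by linarith)
  have key : ∀ n K, toLex (shift K b) ≤ toLex g →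
      val q (shift K b) ≤ 1 + m / (q - 1) * (q⁻¹) ^ n := by
    intro n
    induction n with
    | zero =>
      intro K _
      have := val_le (s := shift K b) hq fun i => hb _
      simp; linarith
    | succ n ih =>
      intro K hK
      rcases hK.lt_or_eq with h1 | h1
      · obtain ⟨d, hag, hlt⟩ := lex_lt_iff.mp h1
        have h2 := val_sub_mul hq (s := shift K b) (fun i => hb _) hg hag
        rw [shift_shift] at h2
        have h3 := ih (K + d + 1) (h _ (hlt.trans_le (hg d)))
        rw [add_assoc] at h3
        have h4 : ((shift K b d : ℕ) : ℝ) + 1 ≤ g d := by exact_mod_cast hlt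
        have h5 := val_nonneg (s := shift (d + 1) g) hq
        have h6 : (val q (shift K b) - val q g) * q ^ (d + 1) ≤ m / (q - 1) * (q⁻¹) ^ n := by
          linarith
        have h7 : val q (shift K b) - val q g ≤ m / (q - 1) * (q⁻¹) ^ n * (q⁻¹) ^ (d + 1) := by
          rw [inv_pow q (d + 1), ← div_eq_mul_inv, le_div_iff₀ (by positivity)]
          exact h6
        have h8 : (q⁻¹) ^ (d + 1) ≤ q⁻¹ := by
          have := pow_le_pow_of_le_one (by positivity) (inv_lt_one_of_one_lt₀ hq).le
            (show 1 ≤ d + 1 by omega)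
          simpa using this
        have h9 : m / (q - 1) * (q⁻¹) ^ n * (q⁻¹) ^ (d + 1) ≤ m / (q - 1) * (q⁻¹) ^ n * q⁻¹ :=
          mul_le_mul_of_nonneg_left h8 (by positivity)
        rw [pow_succ, ← mul_assoc]
        linarith
      · rw [toLex.injective h1]
        have : 0 ≤ (m : ℝ) / (q - 1) * (q⁻¹) ^ (n + 1) := by positivity
        linarith
  have hlim : Filter.Tendsto (fun n : ℕ => 1 + (m : ℝ) / (q - 1) * (q⁻¹) ^ n) Filter.atTop
      (nhds 1) := by
    simpa using ((tendsto_pow_atTop_nhds_zero_of_lt_one (by positivity : (0 : ℝ) ≤ q⁻¹)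
      (inv_lt_one_of_one_lt₀ hq)).const_mul ((m : ℝ) / (q - 1))).const_add 1
  exact ge_of_tendsto' hlim fun n => key n K hK

/-- The alternative `hv'` provides strictness in the two intended cases: `g` = c_ℓ0^∞ in a base
above q_ℓ, where the value is below 1 but tails vanish, and `g` = a^∞ in base q₀, where the value is
1 but all tails are positive. -/
theorem val_shift_lt_one {b g : ℕ → ℕ} (hq : 1 < q) (hb : ∀ i, b i ≤ m) (hg : ∀ i, g i ≤ m)
    (hv : val q g ≤ 1) (hv' : val q g < 1 ∨ ∀ k, 0 < val q (shift k g))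
    (h : ∀ i, b i < m → toLex (shift (i + 1) b) ≤ toLex g) {K : ℕ}
    (hK : toLex (shift K b) < toLex g) : val q (shift K b) < 1 := by
  obtain ⟨d, hag, hlt⟩ := lex_lt_iff.mp hK
  have h2 := val_sub_mul hq (s := shift K b) (fun i => hb _) hg hag
  rw [shift_shift] at h2
  have h3 := val_shift_le_one hq hb hg hv h (h (K + d) (hlt.trans_le (hg d)))
  rw [add_assoc] at h3
  have h4 : ((shift K b d : ℕ) : ℝ) + 1 ≤ g d := by exact_mod_cast hlt
  have hqd : 0 < q ^ (d + 1) := by positivity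
  rcases hv' with h5 | h5
  · have h6 := val_nonneg (s := shift (d + 1) g) hq
    have h7 : (val q (shift K b) - val q g) * q ^ (d + 1) ≤ 0 := by linarith
    have := nonpos_of_mul_nonpos_left h7 hqd
    linarith
  · have h6 := h5 (d + 1)
    have h7 : (val q (shift K b) - val q g) * q ^ (d + 1) < 0 := by linarith
    have := neg_of_mul_neg_left h7 hqd.le
    linarith

theorem isUnivoque_of_lex {b g : ℕ → ℕ} (hq : 1 < q) (hb : ∀ i, b i ≤ m) (hg : ∀ i, g i ≤ m)
    (hv : val q g ≤ 1) (hv' : val q g < 1 ∨ ∀ k, 0 < val q (shift k g))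
    (h1 : ∀ i, b i < m → toLex (shift (i + 1) b) < toLex g)
    (h2 : ∀ i, 0 < b i → toLex (reflectSeq m (shift (i + 1) b)) < toLex g) :
    IsUnivoque m q b := by
  refine ⟨hb, fun i => ⟨fun hi => ?_, fun hi => ?_⟩⟩
  · exact val_shift_lt_one hq hb hg hv hv' (fun i hi => (h1 i hi).le) (h1 i hi)
  · rw [← shift_reflectSeq]
    refine val_shift_lt_one hq (reflectSeq_le m b) hg hv hv' (fun i hi => ?_) (h2 i hi)
    exact (h2 i (by simp only [reflectSeq] at hi; omega)).le

/-- At the first difference `s` gains at least 1, and the tail that `g` has left is worth at most 1.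
-/
theorem one_le_val {g : ℕ → ℕ} (hq : 1 < q) (hg : ∀ i, g i ≤ m) (hs : ∀ i, s i ≤ m)
    (hv : val q g = 1) (hsh : ∀ k, toLex (shift k g) ≤ toLex g) (h : toLex g ≤ toLex s) :
    1 ≤ val q s := by
  rcases h.lt_or_eq with h1 | h1
  · obtain ⟨d, hag, hlt⟩ := lex_lt_iff.mp h1
    have h2 := val_sub_mul hq hs hg fun i hi => (hag i hi).symm
    have h3 := val_shift_le_one hq hg hg hv.le (fun i _ => hsh _) (hsh (d + 1))
    have h4 : (g d : ℝ) + 1 ≤ s d := by exact_mod_cast hlt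
    have h5 := val_nonneg (s := shift (d + 1) s) hq
    have h6 : 0 ≤ (val q s - val q g) * q ^ (d + 1) := by linarith
    have := nonneg_of_mul_nonneg_left h6 (by positivity)
    linarith
  · rw [← toLex.injective h1, hv]

theorem IsUnivoque.lex_lt {b g : ℕ → ℕ} (hq : 1 < q) (hg : ∀ i, g i ≤ m)
    (hv : val q g = 1) (hsh : ∀ k, toLex (shift k g) ≤ toLex g) (hb : IsUnivoque m q b) (i : ℕ) :
    (b i < m → toLex (shift (i + 1) b) < toLex g) ∧
      (0 < b i → toLex (reflectSeq m (shift (i + 1) b)) < toLex g) := by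
  constructor <;> intro hi <;> by_contra h
  · exact absurd ((hb.2 i).1 hi)
      (not_lt.mpr (one_le_val hq hg (fun i => hb.1 _) hv hsh (not_lt.mp h)))
  · exact absurd ((hb.2 i).2 hi)
      (not_lt.mpr (one_le_val hq hg (reflectSeq_le m _) hv hsh (not_lt.mp h)))

/-- A sequence that lowers the last digit of each period of the finite expansion `c` of `1`. -/
theorem val_periodic_eq_one {c g : ℕ → ℕ} {N : ℕ} (hq : 1 < q) (hN : 0 < N)
    (hc : ∀ i, c i ≤ m) (hg : ∀ i, g i ≤ m) (hv : val q c = 1) (hc0 : ∀ i, N ≤ i → c i = 0)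
    (hper : shift N g = g) (hag : ∀ i, i + 1 < N → g i = c i)
    (hlast : g (N - 1) + 1 = c (N - 1)) : val q g = 1 := by
  obtain ⟨d, rfl⟩ : ∃ d, N = d + 1 := ⟨N - 1, by omega⟩
  have h1 := val_sub_mul hq hg hc (d := d) fun i hi => hag i (by omega)
  have h2 : val q (shift (d + 1) c) = 0 := by
    have : shift (d + 1) c = fun _ => 0 := funext fun i => hc0 _ (by omega)
    rw [this, val]; simp
  have h3 : (g d : ℝ) + 1 = c d := by exact_mod_cast hlast
  rw [h2, hper, hv] at h1
  -- The lowered last digit is made up for by the next period: x = val g - 1 satisfies x q^N = x.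
  have h4 : 1 < q ^ (d + 1) := one_lt_pow₀ hq (by omega)
  have h5 : (val q g - 1) * (q ^ (d + 1) - 1) = 0 := by linear_combination h1 + h3
  have := (mul_eq_zero.mp h5).resolve_right (by linarith)
  linarith

end Val

/-! ### The quasi-greedy expansion of `1` -/

section QuasiGreedy

variable {m : ℕ} {q : ℝ} {A : ℕ → ℕ}

/-- Otherwise the tail minus 1 is positive and has an infinite expansion; raising digit `k` and
appending it gives a larger infinite expansion of 1. -/
theorem IsQuasiGreedy.val_shift_le_one (hA : IsQuasiGreedy m q 1 A) (hq : 1 < q)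
    (hqm : q ≤ m + 1) {k : ℕ} (hk : A k < m) : val q (shift (k + 1) A) ≤ 1 := by
  obtain ⟨hm, hv⟩ := (isExpansion_iff hq).mp hA.1
  by_contra h
  have h2 := val_le (s := shift (k + 1) A) hq fun i => hm _
  have hq1 : 0 < q - 1 := by linarith
  obtain ⟨c, hcm, hcinf, hcv⟩ := exists_expansion (m := m) hq hqm
    (y := val q (shift (k + 1) A) - 1) (by linarith) (by linarith)
  have h3 := hA.2.2 (raise A k c)
    ((isExpansion_iff hq).mpr ⟨raise_le hm hk hcm, (val_raise hq hm hk hcm hcv).trans hv⟩) ?_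
  · refine absurd (lex_lt_iff.mpr ⟨k, fun i hi => (raise_of_lt hi).symm, ?_⟩) (not_lt.mpr h3)
    rw [raise_self]; omega
  · rintro ⟨N, hN, hN'⟩
    have hN2 : ∀ i, N < k + 1 + i → c i = 0 := fun i hi => by
      rw [← shift_raise (s := A) (k := k) (c := c)]; exact hN' _ hi
    by_cases hNk : k + 1 ≤ N
    · obtain ⟨e, rfl⟩ := Nat.exists_eq_add_of_le hNk
      refine hcinf ⟨e, ?_, fun i hi => hN2 i (by omega)⟩
      rw [← shift_raise (s := A) (k := k) (c := c)]; exact hN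
    · have h4 : val q c = 0 := by
        have : c = fun _ => 0 := funext fun i => hN2 i (by omega)
        rw [this, val]; simp
      linarith

/-- If a tail first exceeded `A` at `d`, the tail of `A` after `d`, worth at most 1, could not make
up for the lost digit, since what remains of the larger tail is positive; so that tail would be
worth more than 1. -/
theorem IsQuasiGreedy.shift_le (hA : IsQuasiGreedy m q 1 A) (hq : 1 < q) (hqm : q ≤ m + 1)
    (hpos : ∀ k, 0 < val q (shift k A)) (k : ℕ) : toLex (shift k A) ≤ toLex A := by
  obtain ⟨hm, hv⟩ := (isExpansion_iff hq).mp hA.1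
  refine lex_le_self_of_forall hm (fun i hi => ?_) k
  by_contra hlt
  obtain ⟨d, hag, hlt⟩ := lex_lt_iff.mp (not_le.mp hlt)
  have h1 := val_sub_mul hq hm (t := shift (i + 1) A) (fun i => hm _) hag
  have h2 := hA.val_shift_le_one hq hqm hi
  have h3 := hA.val_shift_le_one hq hqm (hlt.trans_le (hm _))
  have h4 := hpos (i + 1 + (d + 1))
  rw [shift_shift, hv] at h1
  have h5 : (A d : ℝ) + 1 ≤ shift (i + 1) A d := by exact_mod_cast hlt
  have h6 : 0 ≤ (1 - val q (shift (i + 1) A)) * q ^ (d + 1) :=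
    mul_nonneg (by linarith) (by positivity)
  linarith

/-- If the first digit is at most m/2, then q is this digit plus a tail worth at most 1, hence at
most ⌊m/2⌋ + 1. -/
theorem IsQuasiGreedy.lt_head (hA : IsQuasiGreedy m q 1 A) (hm : 1 ≤ m) (hqm : q ≤ m + 1)
    (hq : ((m / 2 + 1 : ℕ) : ℝ) < q) : m - A 0 < A 0 := by
  have hq1 : 1 < q := by
    have : (1 : ℝ) ≤ ((m / 2 + 1 : ℕ) : ℝ) := by exact_mod_cast Nat.le_add_left 1 _
    linarith
  obtain ⟨hAm, hv⟩ := (isExpansion_iff hq1).mp hA.1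
  by_contra h
  have h0 : A 0 ≤ m / 2 := by omega
  have h1 := hA.val_shift_le_one hq1 hqm (k := 0) (by omega)
  have h2 := val_head hq1 hAm
  rw [hv] at h2
  have h3 : (A 0 : ℝ) + 1 ≤ ((m / 2 + 1 : ℕ) : ℝ) := by exact_mod_cast Nat.succ_le_succ h0
  simp only [zero_add] at h1
  linarith

/-- The unique expansion of `1` in a base `u ≤ q` close to `q` starts like `A`. -/
theorem IsQuasiGreedy.eventually_agree (hA : IsQuasiGreedy m q 1 A) (hq : 1 < q)
    (hqm : q ≤ m + 1) (hpos : ∀ k, 0 < val q (shift k A)) (N : ℕ) :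
    ∀ᶠ u in nhds q, u ≤ q → ∀ g, IsUnivoque m u g → val u g = 1 → Agree N g A := by
  obtain ⟨hAm, hv⟩ := (isExpansion_iff hq).mp hA.1
  have hpart : ∀ j, ∀ᶠ u in nhds q, ∑ i ∈ Finset.range j, (A i : ℝ) / u ^ (i + 1) < 1 := by
    intro j
    have hcont : ContinuousAt (fun u : ℝ => ∑ i ∈ Finset.range j, (A i : ℝ) / u ^ (i + 1)) q := by
      refine tendsto_finsetSum _ fun i _ => ?_
      exact ContinuousAt.div continuousAt_const (continuousAt_id.pow _) (by positivity)
    refine hcont.eventually_lt_const ?_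
    have h1 := val_split hq hAm j
    have h2 : 0 < val q (shift j A) / q ^ j := div_pos (hpos j) (by positivity)
    rw [hv] at h1
    linarith
  have hall : ∀ᶠ u in nhds q, ∀ j ∈ Finset.range (N + 1),
      ∑ i ∈ Finset.range j, (A i : ℝ) / u ^ (i + 1) < 1 :=
    (Finset.eventually_all _).mpr fun j _ => hpart j
  filter_upwards [hall, lt_mem_nhds hq] with u hu hu1 huq g hg hgv
  intro j hj
  induction j using Nat.strong_induction_on with
  | _ j ih =>
    have hu0 : 0 < u := by linarith
    have hj1 := hu (j + 1) (Finset.mem_range.mpr (by omega))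
    have hsum : ∑ i ∈ Finset.range j, (g i : ℝ) / u ^ (i + 1) =
        ∑ i ∈ Finset.range j, (A i : ℝ) / u ^ (i + 1) :=
      Finset.sum_congr rfl fun i hi => by
        rw [ih i (Finset.mem_range.mp hi) ((Finset.mem_range.mp hi).trans hj)]
    have hsplit := val_split hu1 hg.1 (j + 1)
    rw [hgv, Finset.sum_range_succ, hsum] at hsplit
    rw [Finset.sum_range_succ] at hj1
    rcases lt_trichotomy (g j) (A j) with h1 | h1 | h1
    -- A smaller digit: the tail of `g`, worth less than 1, cannot compensate, so 1 would be at most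
    -- a partial sum for `A`, which is below 1 near `q`.
    · have h2 := (hg.2 j).1 (h1.trans_le (hAm j))
      have h3 : (g j : ℝ) + 1 ≤ A j := by exact_mod_cast h1
      have h4 : (g j : ℝ) / u ^ (j + 1) + val u (shift (j + 1) g) / u ^ (j + 1) ≤
          A j / u ^ (j + 1) := by
        rw [← add_div]
        exact div_le_div_of_nonneg_right (by linarith) (by positivity)
      linarith
    · exact h1
    -- A larger digit: the tail of `A` in base `q` is worth at most 1 and that of `g` is positive.
    -- As `u ≤ q`, the digits of `A` only gain in base `u`, so `g` would be worth more than 1.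
    · have h2 := hA.val_shift_le_one hq hqm (h1.trans_le (hg.1 j))
      have h3 := (hg.2 j).2 (by omega)
      rw [val_reflect (s := shift (j + 1) g) hu1 fun i => hg.1 _] at h3
      have h4 : 1 ≤ (m : ℝ) / (u - 1) := by
        rw [le_div_iff₀ (by linarith)]; linarith
      have h5 : (A j : ℝ) + 1 ≤ g j := by exact_mod_cast h1
      have h6 : (A j : ℝ) / u ^ (j + 1) + 1 / u ^ (j + 1) < g j / u ^ (j + 1) +
          val u (shift (j + 1) g) / u ^ (j + 1) := by
        rw [← add_div, ← add_div]
        exact div_lt_div_of_pos_right (by linarith) (by positivity)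
      have h7 := val_split hq hAm (j + 1)
      rw [hv, Finset.sum_range_succ] at h7
      have h8 : val q (shift (j + 1) A) / q ^ (j + 1) ≤ 1 / u ^ (j + 1) := by
        gcongr
      have h9 : ∑ i ∈ Finset.range j, (A i : ℝ) / q ^ (i + 1) ≤
          ∑ i ∈ Finset.range j, (A i : ℝ) / u ^ (i + 1) :=
        Finset.sum_le_sum fun i _ => by gcongr
      have h10 : (A j : ℝ) / q ^ (j + 1) ≤ A j / u ^ (j + 1) := by gcongr
      linarith

/-- A violation is visible on finitely many digits, which `A` shares with the unique expansion `g`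
of 1 in some base u ≤ q in U. There it would make a reflected tail of `g` exceed `g`, although that
tail is worth less than 1. -/
theorem IsQuasiGreedy.reflect_shift_le (hA : IsQuasiGreedy m q 1 A) (hq : 1 < q)
    (hqm : q ≤ m + 1) (hpos : ∀ k, 0 < val q (shift k A)) (h0 : m - A 0 < A 0)
    (hU : ∃ᶠ u in nhds q, u ≤ q ∧ u ∈ univoqueBases m) (k : ℕ) :
    toLex (reflectSeq m (shift k A)) ≤ toLex A := by
  obtain ⟨hAm, hv⟩ := (isExpansion_iff hq).mp hA.1
  refine reflectSeq_lex_le_of_forall hAm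
    (lex_lt_iff.mpr ⟨0, by simp, h0⟩ : toLex (reflectSeq m A) < toLex A).le (fun i hi => ?_) k
  by_contra hlt
  obtain ⟨d, hag, hlt⟩ := lex_lt_iff.mp (not_le.mp hlt)
  obtain ⟨u, ⟨huq, ⟨hu1, hum⟩, huU⟩, hu⟩ :=
    (hU.and_eventually (hA.eventually_agree hq hqm hpos (i + 1 + (d + 1)))).exists
  obtain ⟨g, hg, -⟩ := huU.2
  have hg1 : IsUnivoque m u g := (mem_univoqueSeqs_iff hu1 hum).mp ⟨1, huU, hg⟩
  have hgv := ((isExpansion_iff hu1).mp hg).2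
  have hgA := hu huq g hg1 hgv
  have h1 := (hg1.2 i).2 (by rw [hgA i (by omega)]; exact hi)
  have hr : ∀ e, e < d + 1 → reflectSeq m (shift (i + 1) g) e =
      reflectSeq m (shift (i + 1) A) e := fun e he => by
    simp only [reflectSeq, shift]
    rw [hgA _ (by omega)]
  have h2 := val_sub_mul hu1 hg1.1 (reflectSeq_le m (shift (i + 1) g)) (d := d) fun e he => by
    rw [hgA e (by omega), hr e (by omega), hag e he]
  have h3 : g d + 1 ≤ reflectSeq m (shift (i + 1) g) d := by
    rw [hgA d (by omega), hr d (by omega)]; exact hlt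
  have h4 := (hg1.2 d).1 (h3.trans (reflectSeq_le m _ d))
  have h5 : (g d : ℝ) + 1 ≤ reflectSeq m (shift (i + 1) g) d := by exact_mod_cast h3
  have h6 := val_nonneg (s := shift (d + 1) (reflectSeq m (shift (i + 1) g))) hu1
  have h7 : 0 < (val u g - val u (reflectSeq m (shift (i + 1) g))) * u ^ (d + 1) :=
    mul_pos (by linarith) (pow_pos (by linarith) _)
  linarith

end QuasiGreedy

/-! ### The left endpoint of a component -/

theorem IsComponent.lt {m : ℕ} {q₀ q₀' : ℝ} (h : IsComponent m q₀ q₀') : q₀ < m + 1 := by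
  obtain ⟨x, hx, hc⟩ := h
  have h1 := mem_connectedComponentIn hx
  rw [hc] at h1
  exact h1.1.trans_le hx.1.2

/-- If q₀ were outside the closure of U, the component could be enlarged to include q₀. Bases of U
near q₀ lie on the left because the component misses U. -/
theorem IsComponent.frequently_mem {m : ℕ} {q₀ q₀' : ℝ} (h : IsComponent m q₀ q₀')
    (hq₀ : ((m / 2 + 1 : ℕ) : ℝ) < q₀) :
    ∃ᶠ u in nhds q₀, u ≤ q₀ ∧ u ∈ univoqueBases m := by
  have hlt := h.lt
  obtain ⟨x, hx, hc⟩ := h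
  set S := Ioc ((m / 2 + 1 : ℕ) : ℝ) (m + 1) \ closure (univoqueBases m)
  have hx1 : x ∈ Ioo q₀ q₀' := hc ▸ mem_connectedComponentIn hx
  have hsub : Ioo q₀ q₀' ⊆ S := hc ▸ connectedComponentIn_subset S x
  have hcl : q₀ ∈ closure (univoqueBases m) := by
    by_contra hn
    have h1 : Ico q₀ q₀' ⊆ S := by
      intro y hy
      rcases hy.1.eq_or_lt with rfl | h2
      · exact ⟨⟨hq₀, hlt.le⟩, hn⟩
      · exact hsub ⟨h2, hy.2⟩
    have h2 := isPreconnected_Ico.subset_connectedComponentIn (Ioo_subset_Ico_self hx1) h1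
    rw [hc] at h2
    exact lt_irrefl _ (h2 ⟨le_rfl, hx1.1.trans hx1.2⟩).1
  refine ((mem_closure_iff_frequently.mp hcl).and_eventually
    (gt_mem_nhds (hx1.1.trans hx1.2))).mono fun u hu => ⟨?_, hu.1⟩
  by_contra hn
  exact (hsub ⟨not_le.mp hn, hu.2⟩).2 (subset_closure hu.1)


/-! ### Words and their concatenation with sequences -/

theorem periodicSeq_of_lt {w : List ℕ} {i : ℕ} (hi : i < w.length) :
    periodicSeq w i = w.getD i 0 := by
  rw [periodicSeq, Nat.mod_eq_of_lt hi]

theorem shift_periodicSeq (w : List ℕ) : shift w.length (periodicSeq w) = periodicSeq w := by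
  funext i; simp [shift, periodicSeq]

theorem shift_mul_of_shift {N : ℕ} {s : ℕ → ℕ} (h : shift N s = s) (j : ℕ) :
    shift (j * N) s = s := by
  induction j with
  | zero => rw [zero_mul, shift_zero]
  | succ j ih => rw [Nat.succ_mul, ← shift_shift, ih, h]

theorem eq_periodicSeq {w : List ℕ} {s : ℕ → ℕ} (hw : w ≠ [])
    (h : ∀ j, ∀ i < w.length, s (j * w.length + i) = w.getD i 0) : s = periodicSeq w := by
  funext i
  have := h (i / w.length) (i % w.length) (Nat.mod_lt _ (List.length_pos_iff.mpr hw))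
  rwa [Nat.div_add_mod'] at this

theorem prependWord_of_lt {w : List ℕ} {s : ℕ → ℕ} {i : ℕ} (hi : i < w.length) :
    prependWord w s i = w.getD i 0 := if_pos hi

theorem prependWord_nil (s : ℕ → ℕ) : prependWord [] s = s := by
  funext i; simp [prependWord]

theorem shift_prependWord (w : List ℕ) (s : ℕ → ℕ) : shift w.length (prependWord w s) = s := by
  funext i; simp [shift, prependWord]

theorem eq_prependWord {w : List ℕ} {s t : ℕ → ℕ} (h : ∀ i < w.length, t i = w.getD i 0)
    (hs : shift w.length t = s) : t = prependWord w s := by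
  funext i
  by_cases hi : i < w.length
  · rw [prependWord_of_lt hi, h i hi]
  · rw [prependWord, if_neg hi, ← hs, shift, Nat.add_sub_cancel' (not_lt.mp hi)]

theorem getD_append_of_lt {u v : List ℕ} {i : ℕ} (hi : i < u.length) :
    (u ++ v).getD i 0 = u.getD i 0 := List.getD_append _ _ _ _ hi

theorem getD_append_add (u v : List ℕ) (i : ℕ) : (u ++ v).getD (u.length + i) 0 = v.getD i 0 := by
  rw [List.getD_append_right _ _ _ _ (by omega)]; simp

theorem prependWord_append (u v : List ℕ) (s : ℕ → ℕ) :
    prependWord (u ++ v) s = prependWord u (prependWord v s) := by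
  symm
  refine eq_prependWord (fun i hi => ?_) ?_
  · by_cases h : i < u.length
    · rw [prependWord_of_lt h, getD_append_of_lt h]
    · obtain ⟨e, rfl⟩ := Nat.exists_eq_add_of_le (not_lt.mp h)
      rw [List.length_append] at hi
      rw [getD_append_add, prependWord, if_neg h, Nat.add_sub_cancel_left,
        prependWord_of_lt (by omega)]
  · rw [List.length_append, ← shift_shift, shift_prependWord, shift_prependWord]

theorem length_reflectWord (m : ℕ) (w : List ℕ) : (reflectWord m w).length = w.length :=
  List.length_map _

theorem getD_reflectWord (m : ℕ) {w : List ℕ} {i : ℕ} (hi : i < w.length) :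
    (reflectWord m w).getD i 0 = m - w.getD i 0 := by
  rw [List.getD_eq_getElem _ _ (by rwa [length_reflectWord]), List.getD_eq_getElem _ _ hi]
  simp [reflectWord]

theorem length_plusWord {w : List ℕ} (hw : w ≠ []) : (plusWord w).length = w.length := by
  have := List.length_pos_iff.mpr hw
  simp [plusWord]; omega

theorem getD_plusWord {w : List ℕ} (hw : w ≠ []) (i : ℕ) :
    (plusWord w).getD i 0 = w.getD i 0 + if i + 1 = w.length then 1 else 0 := by
  have h0 := List.length_pos_iff.mpr hw
  have hlen : w.dropLast.length = w.length - 1 := List.length_dropLast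
  rw [plusWord]
  rcases lt_trichotomy (i + 1) w.length with h | h | h
  · rw [getD_append_of_lt (by omega), if_neg (by omega), List.getD_eq_getElem _ _ (by omega),
      List.getD_eq_getElem _ _ (by omega)]
    simp
  · rw [if_pos h]
    obtain rfl : i = w.dropLast.length + 0 := by omega
    rw [getD_append_add]
    simp [List.getLastD_eq_getLast?, List.getLast?_eq_getElem?, List.getD]
  · rw [if_neg (by omega), List.getD_eq_default _ _ (by simp; omega),
      List.getD_eq_default _ _ (by omega)]

/-! ### The words c_k and their limit sequence -/

theorem cWord_ne_nil (m : ℕ) (a : List ℕ) (k : ℕ) : cWord m a k ≠ [] := by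
  induction k with
  | zero => simp [cWord, plusWord]
  | succ k ih => simp [cWord, ih]

theorem reflectWord_ne_nil (m : ℕ) {w : List ℕ} (hw : w ≠ []) : reflectWord m w ≠ [] := by
  simpa [reflectWord] using hw

theorem length_cWord (m : ℕ) {a : List ℕ} (ha : a ≠ []) (k : ℕ) :
    (cWord m a k).length = a.length * 2 ^ k := by
  induction k with
  | zero => simp [cWord, length_plusWord ha]
  | succ k ih =>
    rw [cWord, List.length_append, length_plusWord (reflectWord_ne_nil m (cWord_ne_nil m a k)),
      length_reflectWord, ih, pow_succ]
    ring

/-- The sequence whose initial words are the `c_k`. -/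
def towerSeq (m : ℕ) (a : List ℕ) : ℕ → ℕ := fun i => (cWord m a i).getD i 0

theorem getD_cWord_of_le (m : ℕ) {a : List ℕ} (ha : a ≠ []) {k l i : ℕ} (hkl : k ≤ l)
    (hi : i < a.length * 2 ^ k) : (cWord m a l).getD i 0 = (cWord m a k).getD i 0 := by
  induction l, hkl using Nat.le_induction with
  | base => rfl
  | succ l hl ih =>
    rw [cWord, getD_append_of_lt, ih]
    rw [length_cWord m ha]
    exact hi.trans_le (IsTower.len_mono _ hl)

theorem towerSeq_eq (m : ℕ) {a : List ℕ} (ha : a ≠ []) {k i : ℕ}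
    (hi : i < a.length * 2 ^ k) : towerSeq m a i = (cWord m a k).getD i 0 := by
  -- The word c_i is longer than i, so `towerSeq` never reads the default digit.
  have hi' : i < a.length * 2 ^ i := by
    have h1 : i < 2 ^ i := Nat.lt_two_pow_self
    have := List.length_pos_iff.mpr ha
    nlinarith
  rcases le_total i k with h | h
  · exact (getD_cWord_of_le m ha h hi').symm
  · exact getD_cWord_of_le m ha h hi

theorem towerSeq_of_lt (m : ℕ) {a : List ℕ} {i : ℕ} (hi : i < a.length) :
    towerSeq m a i = periodicSeq a i + if i + 1 = a.length then 1 else 0 := by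
  have ha : a ≠ [] := List.ne_nil_of_length_pos (by omega)
  rw [towerSeq_eq m ha (k := 0) (by simpa using hi), cWord, getD_plusWord ha,
    periodicSeq_of_lt hi]

theorem towerSeq_succ (m : ℕ) {a : List ℕ} (ha : a ≠ []) {k i : ℕ}
    (hi : i < a.length * 2 ^ k) : towerSeq m a (a.length * 2 ^ k + i) =
      m - towerSeq m a i + if i + 1 = a.length * 2 ^ k then 1 else 0 := by
  have hlen := length_cWord m ha k
  rw [towerSeq_eq m ha (k := k + 1) (by rw [pow_succ, ← mul_assoc]; omega), cWord, ← hlen,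
    getD_append_add, getD_plusWord (reflectWord_ne_nil m (cWord_ne_nil m a k)),
    getD_reflectWord m (by omega), length_reflectWord, towerSeq_eq m ha hi]

/-- For a primitive word, the tails of `a^∞` differ from `a^∞` within the current period. -/
theorem shift_periodicSeq_ltUpTo {a : List ℕ}
    (hmin : ∀ w : List ℕ, w ≠ [] → periodicSeq w = periodicSeq a → a.length ≤ w.length)
    (hsh : ∀ k, toLex (shift k (periodicSeq a)) ≤ toLex (periodicSeq a)) {i : ℕ} (hi0 : 0 < i)
    (hi : i < a.length) : LtUpTo (a.length - i) (shift i (periodicSeq a)) (periodicSeq a) := by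
  rcases ltUpTo_trichotomy (a.length - i) (shift i (periodicSeq a)) (periodicSeq a) with h | h | h
  · exact h
  · exfalso
    -- Cancelling the common word gives A ≤ shift (n - i) A; with the opposite bound, n - i would be
    -- a shorter period.
    have h1 := lex_le_shift h (hsh i)
    rw [shift_shift, Nat.add_sub_cancel' hi.le, shift_periodicSeq] at h1
    have h2 : shift (a.length - i) (periodicSeq a) = periodicSeq a :=
      toLex.injective (le_antisymm (hsh _) h1)
    have hlen : (a.take (a.length - i)).length = a.length - i := by simp
    have h3 := hmin (a.take (a.length - i)) (List.ne_nil_of_length_pos (by omega)) ?_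
    · omega
    · refine (eq_periodicSeq (List.ne_nil_of_length_pos (by omega)) fun j e he => ?_).symm
      rw [hlen] at he ⊢
      have := congrFun (shift_mul_of_shift h2 j) e
      rw [shift] at this
      rw [this, periodicSeq_of_lt (by omega), List.getD_eq_getElem _ _ (by omega),
        List.getD_eq_getElem _ _ (by omega), List.getElem_take]
  · exact absurd h (not_ltUpTo_of_lex_le (hsh i))

/-- Raising the last digit of `a` turns the strict bounds on its proper suffixes (primitivity) into
weak ones, and the weak bounds on its reflected suffixes into strict ones. The raised digit is
allowed because it was below m. -/
theorem isTower_towerSeq {m : ℕ} {a : List ℕ} (ha : a ≠ [])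
    (hmin : ∀ w : List ℕ, w ≠ [] → periodicSeq w = periodicSeq a → a.length ≤ w.length)
    (hm : ∀ i, periodicSeq a i ≤ m) (hlast : periodicSeq a (a.length - 1) < m)
    (h0 : m - periodicSeq a 0 < periodicSeq a 0)
    (hsh : ∀ k, toLex (shift k (periodicSeq a)) ≤ toLex (periodicSeq a))
    (hrefl : ∀ k, toLex (reflectSeq m (shift k (periodicSeq a))) ≤ toLex (periodicSeq a)) :
    IsTower m a.length (towerSeq m a) := by
  have hn := List.length_pos_iff.mpr ha
  have hT : ∀ i, i + 1 < a.length → towerSeq m a i = periodicSeq a i := fun i hi => by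
    rw [towerSeq_of_lt m (by omega), if_neg (by omega), add_zero]
  have hTlast : towerSeq m a (a.length - 1) = periodicSeq a (a.length - 1) + 1 := by
    rw [towerSeq_of_lt m (by omega), if_pos (by omega)]
  refine ⟨hn, fun i hi => ?_, ?_, by omega, fun k i hi => towerSeq_succ m ha hi,
    fun i hi0 hi => ?_⟩
  · rcases Nat.lt_or_ge (i + 1) a.length with h | h
    · rw [hT i h]; exact hm i
    · obtain rfl : i = a.length - 1 := by omega
      omega
  · rw [towerSeq_of_lt m hn]; omega
  · generalize hN : a.length = N at *
    generalize hA : periodicSeq a = A at *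
    generalize hC : towerSeq m a = C at *
    have hlt : LtUpTo (N - i) (shift i A) A := by
      rw [← hN, ← hA] at *
      exact shift_periodicSeq_ltUpTo hmin hsh hi0 hi
    have hT' : ∀ e, i + e + 1 < N → C (i + e) = A (i + e) := fun e he => hT _ he
    constructor
    · rintro ⟨d, hd, hag, hCd⟩
      obtain ⟨f, hf, hfag, hfd⟩ := hlt
      simp only [shift] at *
      have hCA : ∀ e < N - i, C e = A e := fun e he => hT e (by omega)
      rcases Nat.lt_or_ge (i + f + 1) N with h1 | h1
      · have e1 := hT' f h1
        rcases lt_trichotomy d f with h2 | rfl | h2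
        · have := hfag d h2
          rw [hCA d hd, hT' d (by omega)] at hCd
          omega
        · rw [hCA d hd, e1] at hCd; omega
        · have := hag f h2
          rw [hCA f (by omega), e1] at this
          omega
      · have e0 : i + f = N - 1 := by omega
        have e1 : C (i + f) = A (i + f) + 1 := by rw [e0]; exact hTlast
        rcases Nat.lt_or_ge d f with h2 | h2
        · have := hfag d h2
          rw [hCA d hd, hT' d (by omega)] at hCd
          omega
        · obtain rfl : d = f := by omega
          rw [hCA d hd, e1] at hCd; omega
    · have hCA : ∀ e < N - i, C e = A e := fun e he => hT e (by omega)
      have hlast' : C (i + (N - i - 1)) = A (i + (N - i - 1)) + 1 := by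
        have : i + (N - i - 1) = N - 1 := by omega
        rw [this]; exact hTlast
      have hlt' : A (i + (N - i - 1)) < m := by
        have : i + (N - i - 1) = N - 1 := by omega
        rw [this]; exact hlast
      rcases ltUpTo_trichotomy (N - i) (reflectSeq m (shift i A)) A with ⟨d, hd, hag, hd'⟩ | h | h
      · refine ⟨d, hd, fun e he => ?_, ?_⟩
        · have := hag e he
          simp only [shift, reflectSeq] at *
          rw [hCA e (by omega), hT' e (by omega), this]
        · simp only [shift, reflectSeq] at *
          rw [hCA d hd]
          rcases Nat.lt_or_ge (i + d + 1) N with h1 | h1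
          · rwa [hT' d h1]
          · obtain rfl : d = N - i - 1 := by omega
            omega
      · refine ⟨N - i - 1, by omega, fun e he => ?_, ?_⟩
        · have := h e (by omega)
          simp only [shift, reflectSeq] at *
          rw [hCA e (by omega), hT' e (by omega), this]
        · have := h (N - i - 1) (by omega)
          simp only [shift, reflectSeq] at *
          rw [hCA (N - i - 1) (by omega)]
          omega
      · exact absurd h (not_ltUpTo_of_lex_le (hrefl i))

/-! ### Products of blocks -/

theorem ExtWord.append_assoc (x y z : ExtWord) :
    (x.append y).append z = x.append (y.append z) := by
  cases x <;> cases y <;> cases z <;> simp [ExtWord.append, prependWord_append]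

theorem ExtWord.nil_append (x : ExtWord) : (ExtWord.fin []).append x = x := by
  cases x <;> simp [ExtWord.append, prependWord_nil]

theorem wordPow_coe (w : List ℕ) (j : ℕ) :
    wordPow w j = ExtWord.fin (List.replicate j w).flatten := rfl

theorem wordPow_top (w : List ℕ) : wordPow w ⊤ = ExtWord.inf (periodicSeq w) := rfl

theorem wordPow_zero (w : List ℕ) : wordPow w 0 = ExtWord.fin [] := rfl

theorem wordPow_one (w : List ℕ) : wordPow w 1 = ExtWord.fin w := by
  have := wordPow_coe w 1
  simpa using this

/-- The word `c_k` followed by the reflection of `c_{k'}`. -/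
def pairWord (m : ℕ) (a : List ℕ) (k k' : ℕ) : List ℕ :=
  cWord m a k ++ reflectWord m (cWord m a k')

theorem blockProduct_zero (m : ℕ) (a : List ℕ) (i : ℕ → ℕ) (j : ℕ → ℕ∞) (l : ℕ → ℕ) :
    blockProduct m a i j l 0 = wordPow (pairWord m a (i 0) (i 0)) (j 0) := rfl

/-- The product of blocks, with the first block split off. -/
theorem blockProduct_succ (m : ℕ) (a : List ℕ) (i : ℕ → ℕ) (j : ℕ → ℕ∞) (l : ℕ → ℕ) (r : ℕ) :
    blockProduct m a i j l (r + 1) =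
      (wordPow (pairWord m a (i 0) (i 0)) (j 0)).append
        ((wordPow (pairWord m a (i 0) (i 1)) (l 0)).append
          (blockProduct m a (fun s => i (s + 1)) (fun s => j (s + 1)) (fun s => l (s + 1)) r)) := by
  induction r with
  | zero => simp only [blockProduct, ExtWord.append_assoc]; rfl
  | succ r ih =>
    rw [blockProduct, ih, blockProduct]
    simp only [ExtWord.append_assoc]

theorem length_pairWord (m : ℕ) {a : List ℕ} (ha : a ≠ []) (k k' : ℕ) :
    (pairWord m a k k').length = a.length * 2 ^ k + a.length * 2 ^ k' := by
  rw [pairWord, List.length_append, length_reflectWord, length_cWord m ha, length_cWord m ha]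

/-- A sequence that starts with `c_k` and continues with the reflection of `c_{k'}`. -/
theorem getD_pairWord {m : ℕ} {a : List ℕ} (ha : a ≠ []) {k k' : ℕ} {t : ℕ → ℕ}
    (htm : ∀ i, t i ≤ m) (h1 : Agree (a.length * 2 ^ k) t (towerSeq m a))
    (h2 : Agree (a.length * 2 ^ k') (reflectSeq m (shift (a.length * 2 ^ k) t)) (towerSeq m a))
    (i : ℕ) (hi : i < (pairWord m a k k').length) : t i = (pairWord m a k k').getD i 0 := by
  have hlen := length_cWord m ha k
  have hlen' := length_cWord m ha k'
  rw [length_pairWord m ha] at hi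
  rw [pairWord]
  rcases Nat.lt_or_ge i (a.length * 2 ^ k) with h | h
  · rw [getD_append_of_lt (by omega), h1 i h, towerSeq_eq m ha h]
  · obtain ⟨e, rfl⟩ := Nat.exists_eq_add_of_le h
    have h3 := h2 e (by omega)
    have h4 := htm (a.length * 2 ^ k + e)
    rw [towerSeq_eq m ha (k := k') (by omega)] at h3
    rw [← hlen, getD_append_add, getD_reflectWord m (by omega), hlen, ← h3]
    simp only [shift, reflectSeq]
    omega

theorem agree_of_getD_pairWord {m : ℕ} {a : List ℕ} (ha : a ≠ []) {k k' : ℕ} {t : ℕ → ℕ}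
    (hC : ∀ i, towerSeq m a i ≤ m)
    (h : ∀ i < (pairWord m a k k').length, t i = (pairWord m a k k').getD i 0) :
    Agree (a.length * 2 ^ k) t (towerSeq m a) ∧
    Agree (a.length * 2 ^ k') (reflectSeq m (shift (a.length * 2 ^ k) t)) (towerSeq m a) := by
  have hlen := length_cWord m ha k
  have hlen' := length_cWord m ha k'
  rw [length_pairWord m ha] at h
  constructor
  · intro i hi
    rw [h i (by omega), pairWord, getD_append_of_lt (by omega), towerSeq_eq m ha hi]
  · intro i hi
    have h3 := hC i
    rw [towerSeq_eq m ha hi] at h3 ⊢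
    simp only [shift, reflectSeq]
    rw [h _ (by omega), pairWord, ← hlen, getD_append_add, getD_reflectWord m (by omega)]
    omega

theorem prependWord_le {m : ℕ} {w : List ℕ} {s : ℕ → ℕ} (hw : ∀ i < w.length, w.getD i 0 ≤ m)
    (hs : ∀ i, s i ≤ m) (i : ℕ) : prependWord w s i ≤ m := by
  rw [prependWord]
  split_ifs with h
  exacts [hw i h, hs _]

theorem getD_pairWord_le {m : ℕ} {a : List ℕ} (ha : a ≠ []) (hC : ∀ i, towerSeq m a i ≤ m)
    (k k' i : ℕ) (hi : i < (pairWord m a k k').length) : (pairWord m a k k').getD i 0 ≤ m := by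
  have hlen := length_cWord m ha k
  have hlen' := length_cWord m ha k'
  rw [length_pairWord m ha] at hi
  rw [pairWord]
  rcases Nat.lt_or_ge i (a.length * 2 ^ k) with h | h
  · rw [getD_append_of_lt (by omega), ← towerSeq_eq m ha h]; exact hC i
  · obtain ⟨e, rfl⟩ := Nat.exists_eq_add_of_le h
    rw [← hlen, getD_append_add, getD_reflectWord m (by omega)]
    exact Nat.sub_le _ _

/-- The sequences over `{0, …, m}` that start with `c_k` and whose tails lie below `c_ℓ`. -/
def IsBlockSeq (m : ℕ) (a : List ℕ) (ℓ k : ℕ) (t : ℕ → ℕ) : Prop :=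
  (∀ i, t i ≤ m) ∧ Agree (a.length * 2 ^ k) t (towerSeq m a) ∧
    IsTower.TailsBelow m a.length (towerSeq m a) ℓ t

theorem IsBlockSeq.mono {m : ℕ} {a : List ℕ} {ℓ k k' : ℕ} {t : ℕ → ℕ}
    (h : IsBlockSeq m a ℓ k' t) (hk : k ≤ k') : IsBlockSeq m a ℓ k t :=
  ⟨h.1, h.2.1.mono (IsTower.len_mono _ hk), h.2.2⟩

/-- Two applications of `tailsBelow_cons`: first for c̄_{k'} `t` after reflection, where c_{k'} is
followed by the reflection of c_{k'} because `t` starts with c_{k'}; then for the leading c_k, where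
`k ≤ k'` makes c_k a prefix of c_{k'}. -/
theorem IsBlockSeq.cons {m : ℕ} {a : List ℕ} (ha : a ≠ [])
    (hT : IsTower m a.length (towerSeq m a)) {ℓ k k' : ℕ} {t : ℕ → ℕ} (hk : k ≤ k')
    (hl : k' < ℓ) (h : IsBlockSeq m a ℓ k' t) :
    IsBlockSeq m a ℓ k (prependWord (pairWord m a k k') t) := by
  have hs : shift (a.length * 2 ^ k + a.length * 2 ^ k')
      (prependWord (pairWord m a k k') t) = t := by
    rw [← length_pairWord m ha k k', shift_prependWord]
  set s := prependWord (pairWord m a k k') t with hsdef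
  have hsm : ∀ i, s i ≤ m := prependWord_le (getD_pairWord_le ha hT.le k k') h.1
  obtain ⟨h1, h2⟩ := agree_of_getD_pairWord (t := s) ha hT.le fun i hi => prependWord_of_lt hi
  set z := reflectSeq m (shift (a.length * 2 ^ k) s) with hz
  have hz' : reflectSeq m (shift (a.length * 2 ^ k') z) = t := by
    rw [hz, shift_reflectSeq, shift_shift, reflectSeq_reflectSeq (s := shift _ s) fun i => hsm _,
      hs]
  have h3 : IsTower.TailsBelow m a.length (towerSeq m a) ℓ z :=
    hT.tailsBelow_cons hl h2 (by rw [hz']; exact h.2.1) (reflectSeq_le m _)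
      (by rw [hz']; exact h.2.2)
  exact ⟨hsm, h1, hT.tailsBelow_cons (hk.trans_lt hl) h1 (h2.mono (IsTower.len_mono _ hk)) hsm h3⟩

/-- The sequence `(c_k c̄_k)^∞`. -/
theorem periodicSeq_pairWord {m : ℕ} {a : List ℕ} (ha : a ≠ [])
    (hT : IsTower m a.length (towerSeq m a)) (k : ℕ) :
    (∀ i, periodicSeq (pairWord m a k k) i ≤ m) ∧
    Agree (a.length * 2 ^ k) (periodicSeq (pairWord m a k k)) (towerSeq m a) ∧
    reflectSeq m (shift (a.length * 2 ^ k) (periodicSeq (pairWord m a k k))) =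
      periodicSeq (pairWord m a k k) := by
  have hlen := length_pairWord m ha k k
  have hpos := hT.len_pos k
  set t := periodicSeq (pairWord m a k k) with ht
  have htm : ∀ i, t i ≤ m := fun i =>
    getD_pairWord_le ha hT.le k k _ (Nat.mod_lt _ (by omega))
  obtain ⟨h1, h2⟩ := agree_of_getD_pairWord (t := t) ha hT.le fun i hi => periodicSeq_of_lt hi
  have hper : shift (a.length * 2 ^ k + a.length * 2 ^ k) t = t := by
    rw [← hlen]; exact shift_periodicSeq _
  refine ⟨htm, h1, ?_⟩
  have key : ∀ j, ∀ i < a.length * 2 ^ k, t (j * (a.length * 2 ^ k + a.length * 2 ^ k) + i) =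
      towerSeq m a i ∧ m - t (j * (a.length * 2 ^ k + a.length * 2 ^ k) + (a.length * 2 ^ k + i)) =
      towerSeq m a i := fun j i hi => by
    have := shift_mul_of_shift hper j
    have e1 := congrFun this i
    have e2 := congrFun this (a.length * 2 ^ k + i)
    rw [shift] at e1 e2
    rw [e1, e2]
    exact ⟨h1 i hi, h2 i hi⟩
  generalize a.length * 2 ^ k = N at *
  funext x
  obtain ⟨j, e, he, rfl⟩ : ∃ j e, e < N + N ∧ x = j * (N + N) + e :=
    ⟨x / (N + N), x % (N + N), Nat.mod_lt _ (by omega), (Nat.div_add_mod' _ _).symm⟩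
  simp only [shift, reflectSeq]
  rcases Nat.lt_or_ge e N with h | h
  · rw [(key j e h).1, ← (key j e h).2]
    congr 2; ring
  · obtain ⟨f, rfl⟩ := Nat.exists_eq_add_of_le h
    have e1 := (key (j + 1) f (by omega)).1
    have e2 := (key j f (by omega)).2
    have e3 := htm (j * (N + N) + (N + f))
    have e4 : N + (j * (N + N) + (N + f)) = (j + 1) * (N + N) + f := by ring
    rw [e4, e1]
    omega

theorem isBlockSeq_periodic {m : ℕ} {a : List ℕ} (ha : a ≠ [])
    (hT : IsTower m a.length (towerSeq m a)) {ℓ k : ℕ} (hl : k < ℓ) :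
    IsBlockSeq m a ℓ k (periodicSeq (pairWord m a k k)) := by
  obtain ⟨h1, h2, h3⟩ := periodicSeq_pairWord ha hT k
  exact ⟨h1, h2, hT.tailsBelow_periodic hl h2 h3 h1⟩

theorem IsBlockSeq.pow {m : ℕ} {a : List ℕ} (ha : a ≠ [])
    (hT : IsTower m a.length (towerSeq m a)) {ℓ k : ℕ} {t : ℕ → ℕ}
    (hl : k < ℓ) (h : IsBlockSeq m a ℓ k t) (j : ℕ) :
    IsBlockSeq m a ℓ k (prependWord (List.replicate j (pairWord m a k k)).flatten t) := by
  induction j with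
  | zero => simpa [prependWord_nil] using h
  | succ j ih =>
    rw [List.replicate_succ, List.flatten_cons, prependWord_append]
    exact ih.cons ha hT le_rfl hl

/-- Since the product is infinite, some power is; starting from that periodic sequence, blocks are
prepended one at a time, each keeping the tails below c_ℓ. -/
theorem isBlockSeq_of_blockProduct {m : ℕ} {a : List ℕ} (ha : a ≠ [])
    (hT : IsTower m a.length (towerSeq m a)) {ℓ : ℕ} (r : ℕ) :
    ∀ (i : ℕ → ℕ) (j : ℕ → ℕ∞) (l : ℕ → ℕ) (t : ℕ → ℕ), (∀ s < r, i s < i (s + 1)) → i r < ℓ →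
      (∀ s < r, l s ≤ 1) → blockProduct m a i j l r = ExtWord.inf t →
      IsBlockSeq m a ℓ (i 0) t := by
  induction r with
  | zero =>
    intro i j l t _ hl _ h
    rw [blockProduct_zero] at h
    induction hj : j 0 using ENat.recTopCoe with
    | top =>
      rw [hj, wordPow_top] at h
      injection h with h
      rw [← h]
      exact isBlockSeq_periodic ha hT hl
    | coe x =>
      rw [hj, wordPow_coe] at h
      cases h
  | succ r ih =>
    intro i j l t hi hl hl1 h
    have hmono : ∀ s, s ≤ r → i 1 ≤ i (s + 1) := fun s hs => by
      induction s with
      | zero => rfl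
      | succ s ihs => exact (ihs (by omega)).trans (hi (s + 1) (by omega)).le
    have h01 := hi 0 (by omega)
    have h1l : i 1 < ℓ := (hmono r le_rfl).trans_lt hl
    rw [blockProduct_succ] at h
    induction hj : j 0 using ENat.recTopCoe with
    | top =>
      rw [hj, wordPow_top] at h
      injection h with h
      rw [← h]
      exact isBlockSeq_periodic ha hT (h01.trans h1l)
    | coe x =>
      rw [hj, wordPow_coe] at h
      cases hB : blockProduct m a (fun s => i (s + 1)) (fun s => j (s + 1))
        (fun s => l (s + 1)) r with
      | fin w =>
        rw [hB, wordPow_coe] at h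
        cases h
      | inf t' =>
        have h2 := ih _ _ _ t' (fun s hs => hi (s + 1) (by omega)) hl
          (fun s hs => hl1 (s + 1) (by omega)) hB
        rw [hB] at h
        have hl0 := hl1 0 (by omega)
        have h3 : ∃ t'', (wordPow (pairWord m a (i 0) (i 1)) (l 0)).append (ExtWord.inf t') =
            ExtWord.inf t'' ∧ IsBlockSeq m a ℓ (i 0) t'' := by
          rcases Nat.le_one_iff_eq_zero_or_eq_one.mp hl0 with h3 | h3
          · refine ⟨t', ?_, h2.mono h01.le⟩
            rw [h3, Nat.cast_zero, wordPow_zero, ExtWord.nil_append]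
          · refine ⟨_, ?_, h2.cons ha hT h01.le h1l⟩
            rw [h3, Nat.cast_one, wordPow_one]
            rfl
        obtain ⟨t'', h4, h5⟩ := h3
        rw [h4] at h
        injection h with h
        rw [← h]
        exact h5.pow ha hT (h01.trans h1l) x

/-- The sequence `x, f 0, f 1, …`. -/
def seqCons {α : Type*} (x : α) (f : ℕ → α) : ℕ → α
  | 0 => x
  | s + 1 => f s

theorem prependWord_replicate {w : List ℕ} {t : ℕ → ℕ} {J : ℕ}
    (h : ∀ j < J, ∀ i < w.length, t (j * w.length + i) = w.getD i 0) :
    prependWord (List.replicate J w).flatten (shift (J * w.length) t) = t := by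
  induction J with
  | zero => simp [prependWord_nil, shift_zero]
  | succ J ih =>
    rw [List.replicate_succ', List.flatten_append, List.flatten_singleton, prependWord_append]
    have h1 : prependWord w (shift ((J + 1) * w.length) t) = shift (J * w.length) t := by
      symm
      refine eq_prependWord (fun i hi => h J (by omega) i hi) ?_
      rw [shift_shift, Nat.succ_mul]
    rw [h1]
    exact ih fun j hj => h j (by omega)

/-- Copies of c_k c̄_k are removed as long as they are followed by c_k. If this stops, the rest
passes to a strictly larger level, either directly or through one block c_k c̄_{k'}, so the
recursion on `ℓ - k` terminates. -/
theorem exists_blockProduct {m : ℕ} {a : List ℕ} (ha : a ≠ [])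
    (hT : IsTower m a.length (towerSeq m a)) {ℓ : ℕ} {g : ℕ → ℕ}
    (hg : Agree (a.length * 2 ^ ℓ) g (towerSeq m a))
    (hg' : reflectSeq m (shift (a.length * 2 ^ ℓ) g) = g) (hgm : ∀ i, g i ≤ m) {k : ℕ}
    (hk : k < ℓ) {t : ℕ → ℕ} (htm : ∀ i, t i ≤ m) (hB : IsTower.TailsLt m g t)
    (ht : Agree (a.length * 2 ^ k) t (towerSeq m a)) :
    ∃ (r : ℕ) (i : ℕ → ℕ) (j : ℕ → ℕ∞) (l : ℕ → ℕ), i 0 = k ∧ (∀ s < r, i s < i (s + 1)) ∧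
      i r < ℓ ∧ (∀ s < r, l s ≤ 1) ∧ blockProduct m a i j l r = ExtWord.inf t := by
  induction hd : ℓ - k using Nat.strong_induction_on generalizing k t with
  | _ d ih =>
    set N := a.length * 2 ^ k with hN
    set w := pairWord m a k k with hw
    have hwl : w.length = N + N := length_pairWord m ha k k
    have hNpos : 0 < N := hT.len_pos k
    have hblock : ∀ x, Agree N (shift x t) (towerSeq m a) →
        Agree N (reflectSeq m (shift (x + N) t)) (towerSeq m a) →
        ∀ i < w.length, t (x + i) = w.getD i 0 := fun x h1 h2 i hi =>
      getD_pairWord (t := shift x t) ha (fun _ => htm _) h1 (by rwa [shift_shift]) i hi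
    by_cases hall : ∀ J, Agree N (shift (J * w.length) t) (towerSeq m a) ∧
        Agree N (reflectSeq m (shift (J * w.length + N) t)) (towerSeq m a)
    · refine ⟨0, fun _ => k, fun _ => ⊤, fun _ => 0, rfl, by simp, hk, by simp, ?_⟩
      rw [blockProduct_zero, wordPow_top]
      congr 1
      exact (eq_periodicSeq (List.ne_nil_of_length_pos (by omega)) fun j i hi =>
        hblock _ (hall j).1 (hall j).2 i hi).symm
    · -- `J` is the number of initial copies of `c_k` and its reflection, followed by `c_k` again
      have hex : ∃ J, ¬ (Agree N (reflectSeq m (shift (J * w.length + N) t)) (towerSeq m a) ∧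
          Agree N (shift ((J + 1) * w.length) t) (towerSeq m a)) := by
        by_contra hcon
        push Not at hcon
        refine hall fun J => ⟨?_, (hcon J).1⟩
        cases J with
        | zero => rwa [zero_mul, shift_zero]
        | succ J => exact (hcon J).2
      classical
      set J := Nat.find hex with hJ
      have hJspec := Nat.find_spec hex
      rw [← hJ] at hJspec
      have hJmin : ∀ j < J, Agree N (reflectSeq m (shift (j * w.length + N) t)) (towerSeq m a) ∧
          Agree N (shift ((j + 1) * w.length) t) (towerSeq m a) := fun j hj =>
        not_not.mp (Nat.find_min hex hj)
      have hstart : ∀ j ≤ J, Agree N (shift (j * w.length) t) (towerSeq m a) := fun j hj => by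
        cases j with
        | zero => rwa [zero_mul, shift_zero]
        | succ j => exact (hJmin j (by omega)).2
      have hpow : prependWord (List.replicate J w).flatten (shift (J * w.length) t) = t :=
        prependWord_replicate fun j hj => hblock _ (hstart j hj.le) (hJmin j hj).1
      set t' := shift (J * w.length) t with ht'
      have htm' : ∀ i, t' i ≤ m := fun i => htm _
      have hB' : IsTower.TailsLt m g t' := hB.shift _
      have finish : ∀ (k' l₀ : ℕ) (t'' : ℕ → ℕ), k < k' → k' < ℓ → l₀ ≤ 1 →
          (∀ i, t'' i ≤ m) → IsTower.TailsLt m g t'' →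
          Agree (a.length * 2 ^ k') t'' (towerSeq m a) →
          (wordPow (pairWord m a k k') l₀).append (ExtWord.inf t'') = ExtWord.inf t' →
          ∃ (r : ℕ) (i : ℕ → ℕ) (j : ℕ → ℕ∞) (l : ℕ → ℕ), i 0 = k ∧
            (∀ s < r, i s < i (s + 1)) ∧
            i r < ℓ ∧ (∀ s < r, l s ≤ 1) ∧ blockProduct m a i j l r = ExtWord.inf t := by
        intro k' l₀ t'' hkk' hk' hl₀ hm'' hB'' hag'' heq
        obtain ⟨r, i, j, l, hi0, hi, hir, hl, hprod⟩ :=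
          ih (ℓ - k') (by omega) hk' hm'' hB'' hag'' rfl
        refine ⟨r + 1, seqCons k i, seqCons (J : ℕ∞) j, seqCons l₀ l, rfl, ?_, hir, ?_, ?_⟩
        · rintro (_ | s) hs
          · simpa [seqCons, hi0] using hkk'
          · exact hi s (by omega)
        · rintro (_ | s) hs
          · exact hl₀
          · exact hl s (by omega)
        · rw [blockProduct_succ]
          simp only [seqCons]
          rw [hprod, hi0, heq, wordPow_coe]
          simp only [ExtWord.append]
          rw [hpow]
      -- If the longest c_{k₁} starting `t'` has k₁ > k, no linking block is needed. Otherwise c_k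
      -- is followed by a longest c̄_{k₂} and then c_{k₂}: for k₂ > k this is the linking block, and
      -- k₂ = k contradicts the choice of `J`.
      obtain ⟨k₁, hk₁, hk₁l, h1, h2⟩ :=
        hT.exists_agree_reflect hk hg hg' hgm htm' hB' (hstart J le_rfl)
      rcases hk₁.lt_or_eq with hlt | rfl
      · refine finish k₁ 0 t' hlt hk₁l (by omega) htm' hB' h1 ?_
        rw [Nat.cast_zero, wordPow_zero, ExtWord.nil_append]
      · have hBz := (hB'.shift N).reflectSeq fun i => htm' _
        obtain ⟨k₂, hk₂, hk₂l, h3, h4⟩ :=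
          hT.exists_agree_reflect hk hg hg' hgm (reflectSeq_le m _) hBz h2
        rw [shift_reflectSeq, shift_shift,
          reflectSeq_reflectSeq (s := shift _ t') fun i => htm' _] at h4
        rcases hk₂.lt_or_eq with hlt | rfl
        · refine finish k₂ 1 _ hlt hk₂l le_rfl (fun i => htm' _) (hB'.shift _) h4 ?_
          rw [Nat.cast_one, wordPow_one, ExtWord.append]
          congr 1
          symm
          exact eq_prependWord (getD_pairWord ha htm' h1 h3) (by
            rw [length_pairWord m ha]; rfl)
        · refine (hJspec ⟨?_, ?_⟩).elim
          · rw [← shift_shift]; exact h2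
          · rw [Nat.succ_mul, ← shift_shift, ← ht', hwl]; exact h4


/-! ### Matched words -/

theorem list_le_iff {u v : List ℕ} (h : u.length = v.length) :
    u ≤ v ↔ ¬ LtUpTo u.length (fun i => v.getD i 0) (fun i => u.getD i 0) := by
  have e : ∀ (w : List ℕ) (i : ℕ) (hi : i < w.length), w.getD i 0 = w[i] :=
    fun w i hi => List.getD_eq_getElem _ _ hi
  rw [← not_lt, not_iff_not, List.lt_iff_exists]
  constructor
  · rintro (⟨-, h1⟩ | ⟨i, h1, h2, h3, h4⟩)
    · omega
    · refine ⟨i, h2, fun j hj => ?_, ?_⟩ <;> dsimp only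
      · rw [e _ _ (hj.trans h1), e _ _ (hj.trans h2), h3 j hj]
      · rwa [e _ _ h1, e _ _ h2]
  · rintro ⟨i, h2, h3, h4⟩
    have h1 : i < v.length := h ▸ h2
    dsimp only at h3 h4
    refine Or.inr ⟨i, h1, h2, fun j hj => ?_, ?_⟩
    · rw [← e _ _ (hj.trans h1), ← e _ _ (hj.trans h2), h3 j hj]
    · rwa [← e _ _ h1, ← e _ _ h2]

theorem take_ne_replicate_iff {w : List ℕ} {k x : ℕ} (hk : k ≤ w.length) :
    w.take k ≠ List.replicate k x ↔ ∃ i < k, w.getD i 0 ≠ x := by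
  rw [← not_iff_not]
  push Not
  constructor
  · intro h i hi
    have h1 : (w.take k).getD i 0 = (List.replicate k x).getD i 0 := by rw [h]
    rw [List.getD_eq_getElem _ _ (by simp; omega), List.getD_eq_getElem _ _ (by simpa using hi),
      List.getElem_take, List.getElem_replicate] at h1
    rw [List.getD_eq_getElem _ _ (by omega), h1]
  · intro h
    refine List.ext_getElem (by simpa using hk) fun i h1 h2 => ?_
    have h3 := h i (by simpa using h2)
    rw [List.getD_eq_getElem _ _ (by simp at h2; omega)] at h3
    simpa using h3

theorem getD_window {a u : List ℕ} {k i : ℕ} (hk : k ≤ u.length) (hi : i < a.length) :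
    (((u ++ a).drop k).take a.length).getD i 0 = shift k (prependWord u (periodicSeq a)) i := by
  rw [List.getD_eq_getElem _ _ (by simp; omega), List.getElem_take, List.getElem_drop,
    ← List.getD_eq_getElem (d := 0), shift]
  by_cases h : k + i < u.length
  · rw [prependWord_of_lt h, getD_append_of_lt h]
  · obtain ⟨e, he⟩ := Nat.exists_eq_add_of_le (not_lt.mp h)
    rw [he, getD_append_add, prependWord, if_neg (by omega), Nat.add_sub_cancel_left,
      periodicSeq_of_lt (by omega)]

/-- For k ≤ |u| the window lies inside ua, so it is the start of a tail of ua^∞, and the conditions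
on initial words say that a digit below m, or above 0, has already occurred. -/
theorem isMatched_iff {m : ℕ} {a u : List ℕ} :
    IsMatched m a u ↔ u ≠ [] ∧ (∀ i < u.length, u.getD i 0 ≤ m) ∧ u.getD (u.length - 1) 0 < m ∧
      ∀ k, 1 ≤ k → k ≤ u.length →
        ((∃ i < k, u.getD i 0 ≠ m) →
          ¬ LtUpTo a.length (periodicSeq a) (shift k (prependWord u (periodicSeq a)))) ∧
        ((∃ i < k, u.getD i 0 ≠ 0) →
          ¬ LtUpTo a.length (shift k (prependWord u (periodicSeq a)))
            (reflectSeq m (periodicSeq a))) := by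
  have hlast : u.getLastD 0 = u.getD (u.length - 1) 0 := by
    simp [List.getLastD_eq_getLast?, List.getLast?_eq_getElem?, List.getD]
  have hdig : (∀ d ∈ u, d ≤ m) ↔ ∀ i < u.length, u.getD i 0 ≤ m := by
    constructor
    · intro h i hi
      rw [List.getD_eq_getElem _ _ hi]
      exact h _ (List.getElem_mem hi)
    · intro h d hd
      obtain ⟨i, hi, rfl⟩ := List.getElem_of_mem hd
      rw [← List.getD_eq_getElem (d := 0)]
      exact h i hi
  have hwin : ∀ k ≤ u.length, (((u ++ a).drop k).take a.length).length = a.length :=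
    fun k hk => by simp; omega
  have hle : ∀ k ≤ u.length, ((((u ++ a).drop k).take a.length ≤ a) ↔
      ¬ LtUpTo a.length (periodicSeq a) (shift k (prependWord u (periodicSeq a)))) := by
    intro k hk
    rw [list_le_iff (hwin k hk), hwin k hk, not_iff_not]
    have e1 : Agree a.length (fun i => a.getD i 0) (periodicSeq a) :=
      fun i hi => (periodicSeq_of_lt hi).symm
    have e2 : Agree a.length (fun i => (((u ++ a).drop k).take a.length).getD i 0)
      (shift k (prependWord u (periodicSeq a))) := fun i hi => getD_window hk hi
    exact ⟨fun h => h.congr e1 e2, fun h => h.congr e1.symm e2.symm⟩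
  have hge : ∀ k ≤ u.length, ((reflectWord m a ≤ ((u ++ a).drop k).take a.length) ↔
      ¬ LtUpTo a.length (shift k (prependWord u (periodicSeq a)))
            (reflectSeq m (periodicSeq a))) := by
    intro k hk
    rw [list_le_iff (by rw [hwin k hk, length_reflectWord]), length_reflectWord, not_iff_not]
    have e1 : Agree a.length (fun i => (reflectWord m a).getD i 0)
      (reflectSeq m (periodicSeq a)) := fun i hi => by
        simp only [reflectSeq]
        rw [periodicSeq_of_lt hi, getD_reflectWord m hi]
    have e2 : Agree a.length (fun i => (((u ++ a).drop k).take a.length).getD i 0)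
      (shift k (prependWord u (periodicSeq a))) := fun i hi => getD_window hk hi
    exact ⟨fun h => h.congr e2 e1, fun h => h.congr e2.symm e1.symm⟩
  rw [IsMatched, hlast, hdig]
  refine and_congr_right fun _ => and_congr_right fun _ => and_congr_right fun _ =>
    forall_congr' fun k => forall_congr' fun _ => forall_congr' fun hk => ?_
  rw [take_ne_replicate_iff hk, take_ne_replicate_iff hk, hle k hk, hge k hk]

/-! ### The two directions of the description -/

section Main

variable {m : ℕ} {a : List ℕ}

theorem le_towerSeq {i : ℕ} (hi : i < a.length) : periodicSeq a i ≤ towerSeq m a i := by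
  rw [towerSeq_of_lt m hi]; omega

theorem towerSeq_eq_periodicSeq {i : ℕ} (hi : i + 1 < a.length) :
    towerSeq m a i = periodicSeq a i := by
  rw [towerSeq_of_lt m (by omega), if_neg (by omega), add_zero]

/-- For words of length n, being at most a and being below a⁺ are the same. -/
theorem ltUpTo_towerSeq (ha : a ≠ []) {s : ℕ → ℕ} (h : ¬ LtUpTo a.length (periodicSeq a) s) :
    LtUpTo a.length s (towerSeq m a) := by
  have hn := List.length_pos_iff.mpr ha
  rcases ltUpTo_trichotomy a.length s (periodicSeq a) with ⟨d, hd, hag, hlt⟩ | h1 | h1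
  · refine ⟨d, hd, fun i hi => ?_, hlt.trans_le (le_towerSeq hd)⟩
    rw [hag i hi, towerSeq_eq_periodicSeq (by omega)]
  · refine ⟨a.length - 1, by omega, fun i hi => ?_, ?_⟩
    · rw [h1 i (by omega), towerSeq_eq_periodicSeq (by omega)]
    · rw [h1 _ (by omega), towerSeq_of_lt m (by omega), if_pos (by omega)]
      omega
  · exact absurd h1 h

/-- No word of length n lies strictly between a and a⁺. -/
theorem agree_towerSeq {s : ℕ → ℕ}
    (h1 : LtUpTo a.length (periodicSeq a) s) (h2 : ¬ LtUpTo a.length (towerSeq m a) s) :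
    Agree a.length s (towerSeq m a) := by
  rcases ltUpTo_trichotomy a.length s (towerSeq m a) with ⟨d, hd, hag, hlt⟩ | h | h
  · exfalso
    obtain ⟨e, he, hage, hlte⟩ := h1
    rcases lt_trichotomy d e with h3 | rfl | h3
    · have := hage d h3
      rw [towerSeq_eq_periodicSeq (by omega)] at hlt
      omega
    · rw [towerSeq_of_lt m hd] at hlt
      split_ifs at hlt <;> omega
    · have := hag e h3
      rw [towerSeq_eq_periodicSeq (by omega)] at this
      omega
  · exact h
  · exact absurd h h2

theorem agree_periodicSeq {s : ℕ → ℕ} (h1 : ¬ LtUpTo a.length s (periodicSeq a))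
    (h2 : ¬ LtUpTo a.length (towerSeq m a) s) : Agree (a.length - 1) s (periodicSeq a) := by
  rcases ltUpTo_trichotomy (a.length - 1) s (periodicSeq a) with h | h | h
  · exact absurd (h.mono (by omega)) h1
  · exact h
  · refine absurd ((h.congr (fun i hi => ?_) fun _ _ => rfl).mono (by omega)) h2
    exact (towerSeq_eq_periodicSeq (by omega)).symm

theorem not_ltUpTo_reflect {n : ℕ} {s A : ℕ → ℕ} (hs : ∀ i, s i ≤ m)
    (h : ¬ LtUpTo n s (reflectSeq m A)) : ¬ LtUpTo n A (reflectSeq m s) := by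
  rintro ⟨d, hd, hag, hlt⟩
  refine h ⟨d, hd, fun i hi => ?_, ?_⟩
  · have := hag i hi
    have := hs i
    simp only [reflectSeq] at *
    omega
  · simp only [reflectSeq] at *
    omega

/-- The digits and tails of a matched word followed by a sequence with small tails. -/
theorem IsMatched.tails_below {ω : List ℕ} {t : ℕ → ℕ} {ℓ : ℕ} (ha : a ≠ [])
    (hω : IsMatched m a ω) (htm : ∀ i, t i ≤ m) (hag : Agree (a.length - 1) t (periodicSeq a))
    (hA : toLex (periodicSeq a) ≤ toLex t)
    (ht : IsTower.TailsBelow m a.length (towerSeq m a) ℓ t) :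
    (∀ i, prependWord ω t i ≤ m) ∧
    (∀ i, prependWord ω t i < m →
      LtUpTo (a.length * 2 ^ ℓ) (shift (i + 1) (prependWord ω t)) (towerSeq m a)) ∧
    (∀ i, 0 < prependWord ω t i →
      LtUpTo (a.length * 2 ^ ℓ) (reflectSeq m (shift (i + 1) (prependWord ω t)))
        (towerSeq m a)) ∧
    ∃ i, prependWord ω t i < m ∧
      toLex (periodicSeq a) ≤ toLex (shift (i + 1) (prependWord ω t)) := by
  obtain ⟨hne, hdig, hlast, hwin⟩ := isMatched_iff.mp hω
  have hp := List.length_pos_iff.mpr hne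
  have hbm := prependWord_le hdig htm
  have hlen : a.length ≤ a.length * 2 ^ ℓ := Nat.le_mul_of_pos_right _ (by positivity)
  have hsh := shift_prependWord ω t
  set b := prependWord ω t with hb
  have hbω : ∀ i < ω.length, b i = ω.getD i 0 := fun i hi => prependWord_of_lt hi
  have hout : ∀ i, ω.length ≤ i + 1 →
      LtUpTo (a.length * 2 ^ ℓ) (shift (i + 1) b) (towerSeq m a) ∧
      LtUpTo (a.length * 2 ^ ℓ) (reflectSeq m (shift (i + 1) b)) (towerSeq m a) := by
    intro i hi
    obtain ⟨e, he⟩ := Nat.exists_eq_add_of_le hi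
    rw [he, ← shift_shift, hsh]
    exact ht e
  -- A window starting inside ω reaches at most n - 1 letters beyond it, so it does not distinguish
  -- a from a⁺.
  have hin : ∀ i, i + 1 < ω.length → Agree a.length
      (shift (i + 1) (prependWord ω (periodicSeq a))) (shift (i + 1) b) := by
    intro i hi e he
    simp only [shift]
    by_cases h : i + 1 + e < ω.length
    · rw [hbω _ h, prependWord_of_lt h]
    · rw [hb, prependWord, prependWord, if_neg h, if_neg h]
      exact (hag _ (by omega)).symm
  refine ⟨hbm, fun i hi => ?_, fun i hi => ?_, ω.length - 1, ?_, ?_⟩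
  · rcases Nat.lt_or_ge (i + 1) ω.length with h | h
    · refine (ltUpTo_towerSeq ha fun hlt => ?_).mono hlen
      refine (hwin (i + 1) (by omega) h.le).1 ⟨i, by omega, ?_⟩
        (hlt.congr (fun _ _ => rfl) (hin i h).symm)
      rw [← hbω i (by omega)]; omega
    · exact (hout i h).1
  · rcases Nat.lt_or_ge (i + 1) ω.length with h | h
    · refine (ltUpTo_towerSeq ha (not_ltUpTo_reflect (fun i => hbm _) fun hlt => ?_)).mono hlen
      refine (hwin (i + 1) (by omega) h.le).2 ⟨i, by omega, ?_⟩
        (hlt.congr (hin i h).symm fun _ _ => rfl)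
      rw [← hbω i (by omega)]; omega
    · exact (hout i h).2
  · rw [hbω _ (by omega)]; exact hlast
  · rw [Nat.sub_add_cancel hp, hsh]
    exact hA

theorem HasBlockForm.tails_below {b : ℕ → ℕ} {ℓ : ℕ} (ha : a ≠ [])
    (hT : IsTower m a.length (towerSeq m a)) (hm : ∀ i, periodicSeq a i ≤ m)
    (hsh : ∀ k, toLex (shift k (periodicSeq a)) ≤ toLex (periodicSeq a))
    (hrefl : ∀ k, toLex (reflectSeq m (shift k (periodicSeq a))) ≤ toLex (periodicSeq a))
    (hb : HasBlockForm m a ℓ b) :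
    (∀ i, b i ≤ m) ∧
    (∀ i, b i < m → LtUpTo (a.length * 2 ^ ℓ) (shift (i + 1) b) (towerSeq m a)) ∧
    (∀ i, 0 < b i → LtUpTo (a.length * 2 ^ ℓ) (reflectSeq m (shift (i + 1) b))
        (towerSeq m a)) ∧
    ∃ i, b i < m ∧ toLex (periodicSeq a) ≤ toLex (shift (i + 1) b) := by
  obtain ⟨ω, e, r, i, j, l, hω, he, hi, hir, hl, h⟩ := hb
  have hlen : a.length ≤ a.length * 2 ^ ℓ := Nat.le_mul_of_pos_right _ (by positivity)
  have hn := List.length_pos_iff.mpr ha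
  rcases he with rfl | rfl
  · rw [wordPow_zero] at h
    simp only [ExtWord.append, List.append_nil] at h
    cases hB : blockProduct m a i j l r with
    | fin w => rw [hB] at h; cases h
    | inf t =>
      rw [hB] at h
      injection h with h
      rw [← h]
      obtain ⟨h1, h2, h3⟩ := isBlockSeq_of_blockProduct ha hT r i j l t hi hir hl hB
      have h2' : Agree a.length t (towerSeq m a) :=
        h2.mono (Nat.le_mul_of_pos_right _ (by positivity))
      refine hω.tails_below ha h1 (fun i hi => ?_) ?_ h3
      · rw [h2' i (by omega), towerSeq_eq_periodicSeq (by omega)]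
      · have := ltUpTo_towerSeq (m := m) ha (s := periodicSeq a) fun h => lt_irrefl _ h.lex_lt
        exact (this.congr (fun _ _ => rfl) h2'.symm).lex_lt.le
  · rw [wordPow_top] at h
    simp only [ExtWord.append] at h
    injection h with h
    rw [← h]
    exact hω.tails_below ha hm (fun _ _ => rfl) le_rfl fun K =>
      ⟨(ltUpTo_towerSeq ha (not_ltUpTo_of_lex_le (hsh K))).mono hlen,
        (ltUpTo_towerSeq ha (not_ltUpTo_of_lex_le (hrefl K))).mono hlen⟩

/-- The word formed by the first `p` digits of `b`. -/
def prefixWord (b : ℕ → ℕ) (p : ℕ) : List ℕ := (List.range p).map b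

theorem length_prefixWord (b : ℕ → ℕ) (p : ℕ) : (prefixWord b p).length = p := by
  simp [prefixWord]

theorem getD_prefixWord (b : ℕ → ℕ) {p i : ℕ} (hi : i < p) : (prefixWord b p).getD i 0 = b i := by
  rw [List.getD_eq_getElem _ _ (by rwa [length_prefixWord])]
  simp [prefixWord]

theorem prependWord_prefixWord (b : ℕ → ℕ) (p : ℕ) :
    prependWord (prefixWord b p) (shift p b) = b := by
  symm
  refine eq_prependWord (fun i hi => ?_) (by rw [length_prefixWord])
  rw [length_prefixWord] at hi
  exact (getD_prefixWord b hi).symm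

/-- Prefixes of `b` that end some periods `a` after the first tail not below `a^∞`. -/
theorem isMatched_prefixWord {b : ℕ → ℕ} {p J : ℕ} (ha : a ≠ []) (hbm : ∀ i, b i ≤ m)
    (hm : ∀ i, periodicSeq a i ≤ m)
    (hsh : ∀ k, toLex (shift k (periodicSeq a)) ≤ toLex (periodicSeq a))
    (hrefl : ∀ k, toLex (reflectSeq m (shift k (periodicSeq a))) ≤ toLex (periodicSeq a))
    (hp : 0 < p) (hag : Agree (a.length - 1) (shift p b) (periodicSeq a))
    (hmin : ∀ i, i + 1 < p → b i < m → toLex (shift (i + 1) b) < toLex (periodicSeq a))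
    (hmin' : ∀ i, i + 1 < p → 0 < b i →
      toLex (reflectSeq m (shift (i + 1) b)) < toLex (periodicSeq a))
    (hJ : ∀ i < J * a.length, b (p + i) = periodicSeq a i)
    (hlast : b (p + J * a.length - 1) < m) :
    IsMatched m a (prefixWord b (p + J * a.length)) := by
  have hn := List.length_pos_iff.mpr ha
  set P := p + J * a.length with hP
  -- The extra copies of a are absorbed by a^∞, so for k ≥ p the conditions concern tails of a^∞
  -- only.
  have hW : prependWord (prefixWord b P) (periodicSeq a) =
      prependWord (prefixWord b p) (periodicSeq a) := by
    symm
    refine eq_prependWord (fun i hi => ?_) ?_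
    · rw [length_prefixWord] at hi
      rw [getD_prefixWord b hi]
      by_cases h : i < p
      · rw [prependWord_of_lt (by rwa [length_prefixWord]), getD_prefixWord b h]
      · obtain ⟨e, rfl⟩ := Nat.exists_eq_add_of_le (not_lt.mp h)
        rw [prependWord, if_neg (by rwa [length_prefixWord]), length_prefixWord,
          Nat.add_sub_cancel_left, hJ e (by omega)]
    · have := shift_prependWord (prefixWord b p) (periodicSeq a)
      rw [length_prefixWord] at this
      rw [length_prefixWord, hP, ← shift_shift, this, shift_mul_of_shift (shift_periodicSeq a)]
  have hWs := shift_prependWord (prefixWord b p) (periodicSeq a)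
  rw [length_prefixWord] at hWs
  rw [isMatched_iff, hW, length_prefixWord]
  refine ⟨List.ne_nil_of_length_pos (by rw [length_prefixWord]; omega), fun i hi => ?_, ?_,
    fun k hk hkP => ?_⟩
  · rw [getD_prefixWord b hi]; exact hbm i
  · rw [getD_prefixWord b (by omega)]; exact hlast
  · set W := prependWord (prefixWord b p) (periodicSeq a) with hWdef
    have hWb : k < p → Agree a.length (shift k W) (shift k b) := fun hkp e he => by
      simp only [shift]
      by_cases h : k + e < p
      · rw [hWdef, prependWord_of_lt (by rwa [length_prefixWord]), getD_prefixWord b h]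
      · obtain ⟨f, hf⟩ := Nat.exists_eq_add_of_le (not_lt.mp h)
        have h1 := congrFun hWs f
        simp only [shift] at h1
        rw [hf, h1]
        exact (hag f (by omega)).symm
    have hA0 : ∀ {s : ℕ → ℕ}, (∀ i, s i ≤ m) →
        toLex (reflectSeq m s) ≤ toLex (periodicSeq a) →
        ¬ LtUpTo a.length s (reflectSeq m (periodicSeq a)) := by
      intro s hs h
      have h1 := not_ltUpTo_of_lex_le (n := a.length) h
      rintro ⟨d, hd, hag, hlt⟩
      refine h1 ⟨d, hd, fun i hi => ?_, ?_⟩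
      · have := hag i hi
        have := hm i
        simp only [reflectSeq] at *
        omega
      · simp only [reflectSeq] at *
        omega
    rcases Nat.lt_or_ge k p with hkp | hkp
    · constructor
      · rintro ⟨i, hi, hne⟩
        rw [getD_prefixWord b (by omega)] at hne
        have h1 := lex_lt_of_exists_lt hbm hm k (fun i hi => hmin i (by omega))
          ⟨i, hi, lt_of_le_of_ne (hbm i) hne⟩
        exact fun h => not_ltUpTo_of_lex_le h1.le (h.congr (fun _ _ => rfl) (hWb hkp))
      · rintro ⟨i, hi, hne⟩
        rw [getD_prefixWord b (by omega)] at hne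
        have h1 := lex_lt_of_exists_lt (reflectSeq_le m b) hm k (fun i hi hlt =>
          hmin' i (by omega) (by simp only [reflectSeq] at hlt; omega))
          ⟨i, hi, by have := hbm i; simp only [reflectSeq]; omega⟩
        rw [shift_reflectSeq] at h1
        exact fun h => hA0 (fun i => hbm _) h1.le (h.congr (hWb hkp) fun _ _ => rfl)
    · obtain ⟨e, rfl⟩ := Nat.exists_eq_add_of_le hkp
      rw [← shift_shift, hWs]
      exact ⟨fun _ => not_ltUpTo_of_lex_le (hsh e), fun _ => hA0 (fun i => hm _) (hrefl e)⟩

/-- The tail after `p` lies between a^∞ and `g`, so it is a^∞ or a^J a⁺⋯ for some J. In the second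
case the word ω ends after a^J, and the rest, starting with c₀, is decomposed by
`exists_blockProduct`. -/
theorem hasBlockForm_of_lex {b g : ℕ → ℕ} {ℓ p : ℕ} (ha : a ≠ [])
    (hT : IsTower m a.length (towerSeq m a)) (hm : ∀ i, periodicSeq a i ≤ m)
    (hlast : periodicSeq a (a.length - 1) < m)
    (hsh : ∀ k, toLex (shift k (periodicSeq a)) ≤ toLex (periodicSeq a))
    (hrefl : ∀ k, toLex (reflectSeq m (shift k (periodicSeq a))) ≤ toLex (periodicSeq a))
    (hℓ : 1 ≤ ℓ) (hg : Agree (a.length * 2 ^ ℓ) g (towerSeq m a))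
    (hg' : reflectSeq m (shift (a.length * 2 ^ ℓ) g) = g) (hgm : ∀ i, g i ≤ m)
    (hbm : ∀ i, b i ≤ m) (hbg : ∀ i, b i < m → toLex (shift (i + 1) b) < toLex g)
    (hbg' : ∀ i, 0 < b i → toLex (reflectSeq m (shift (i + 1) b)) < toLex g)
    (hp : b p < m) (hpA : toLex (periodicSeq a) ≤ toLex (shift (p + 1) b))
    (hmin : ∀ i < p, b i < m → toLex (shift (i + 1) b) < toLex (periodicSeq a))
    (hmin' : ∀ i < p, 0 < b i →
      toLex (reflectSeq m (shift (i + 1) b)) < toLex (periodicSeq a)) :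
    HasBlockForm m a ℓ b := by
  have hn := List.length_pos_iff.mpr ha
  have hlen : a.length ≤ a.length * 2 ^ ℓ := Nat.le_mul_of_pos_right _ (by positivity)
  have hgC : ∀ {s : ℕ → ℕ}, toLex s < toLex g → ¬ LtUpTo a.length (towerSeq m a) s :=
    fun h1 h2 => not_ltUpTo_of_lex_le h1.le
      (h2.congr (hg.mono hlen).symm fun _ _ => rfl)
  have hag : Agree (a.length - 1) (shift (p + 1) b) (periodicSeq a) :=
    agree_periodicSeq (not_ltUpTo_of_lex_le hpA) (hgC (hbg p hp))
  have hmatch : ∀ J, (∀ i < J * a.length, b (p + 1 + i) = periodicSeq a i) →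
      b (p + 1 + J * a.length - 1) < m → IsMatched m a (prefixWord b (p + 1 + J * a.length)) :=
    fun J h1 h2 => isMatched_prefixWord ha hbm hm hsh hrefl (Nat.succ_pos p) hag
      (fun i hi => hmin i (by omega)) (fun i hi => hmin' i (by omega)) h1 h2
  rcases hpA.eq_or_lt with h | h
  · have hAeq : shift (p + 1) b = periodicSeq a := (toLex.injective h).symm
    refine ⟨prefixWord b (p + 1), ⊤, 0, fun _ => 0, fun _ => 0, fun _ => 0, ?_, Or.inr rfl,
      by simp, hℓ, by simp, ?_⟩
    · simpa using hmatch 0 (by simp) (by simpa using hp)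
    · rw [wordPow_top]
      simp only [ExtWord.append]
      rw [← hAeq, prependWord_prefixWord]
  · obtain ⟨d, hdag, hdlt⟩ := lex_lt_iff.mp h
    -- `J` counts the full periods of a before the first difference from a^∞.
    obtain ⟨J, e, he, rfl⟩ : ∃ J e, e < a.length ∧ d = J * a.length + e :=
      ⟨d / a.length, d % a.length, Nat.mod_lt _ hn, (Nat.div_add_mod' _ _).symm⟩
    set P := p + 1 + J * a.length with hP
    have hper := shift_mul_of_shift (shift_periodicSeq a) J
    have hlastP : b (P - 1) < m := by
      cases J with
      | zero => simpa [hP] using hp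
      | succ J =>
        have h1 := hdag (J * a.length + (a.length - 1)) (by rw [Nat.succ_mul]; omega)
        have h2 := congrFun (shift_mul_of_shift (shift_periodicSeq a) J) (a.length - 1)
        have h3 : p + 1 + (J * a.length + (a.length - 1)) = P - 1 := by
          rw [hP, Nat.succ_mul]; omega
        simp only [shift] at h1 h2
        rw [h3, h2] at h1
        omega
    have hAt : LtUpTo a.length (periodicSeq a) (shift P b) := by
      refine ⟨e, he, fun i hi => ?_, ?_⟩
      · have h1 := hdag (J * a.length + i) (by omega)
        have h2 := congrFun hper i
        simp only [shift] at *
        rw [hP, add_assoc (p + 1), ← h1, h2]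
      · have h2 := congrFun hper e
        simp only [shift] at *
        rw [hP, add_assoc (p + 1)]
        omega
    have hbP := hbg (P - 1) hlastP
    have hP1 : P - 1 + 1 = P := by omega
    rw [hP1] at hbP
    have htC := agree_towerSeq hAt (hgC hbP)
    have hbP0 : b P = towerSeq m a 0 := by simpa [shift] using htC 0 hn
    have hC0 := hT.reflect_lt
    -- The digit before `P` is below m and the digit at `P` is positive, so from here on the
    -- conditional bounds hold for all tails; the reflected tail at `P` itself is decided by its
    -- first digit.
    have hB : IsTower.TailsLt m g (shift P b) := by
      intro K
      rw [shift_shift]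
      refine ⟨lex_lt_of_exists_lt hbm hgm _ (fun i _ => hbg i) ⟨P - 1, by omega, hlastP⟩, ?_⟩
      rcases Nat.eq_zero_or_pos K with rfl | hK
      · refine lex_lt_iff.mpr ⟨0, by simp, ?_⟩
        rw [hg 0 (by omega)]
        simp only [shift, reflectSeq, add_zero, hbP0]
        exact hC0
      · rw [← shift_reflectSeq]
        refine lex_lt_of_exists_lt (reflectSeq_le m b) hgm _ (fun i _ hi => ?_) ⟨P, by omega, ?_⟩
        · rw [shift_reflectSeq]
          exact hbg' i (by simp only [reflectSeq] at hi; omega)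
        · have := hT.le 0
          simp only [reflectSeq, hbP0]; omega
    obtain ⟨r, i, j, l, -, hi, hir, hl, hprod⟩ :=
      exists_blockProduct (t := shift P b) ha hT hg hg' hgm hℓ (fun i => hbm _) hB
        (by simpa using htC)
    refine ⟨prefixWord b P, 0, r, i, j, l, hmatch J (fun i hi => ?_) hlastP, Or.inl rfl, hi, hir,
      hl, ?_⟩
    · have := hdag i (by omega)
      rw [this]; rfl
    · rw [wordPow_zero, hprod]
      simp only [ExtWord.append, List.append_nil]
      rw [prependWord_prefixWord]

end Main

/-! ### The bases `q_ℓ` -/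

section Bases

variable {m : ℕ} {a : List ℕ}

theorem agree_prependWord_cWord (ha : a ≠ []) (k : ℕ) (s : ℕ → ℕ) :
    Agree (a.length * 2 ^ k) (prependWord (cWord m a k) s) (towerSeq m a) := fun i hi => by
  rw [prependWord_of_lt (by rwa [length_cWord m ha]), towerSeq_eq m ha hi]

theorem le_of_isExpansion {q : ℝ} {c : ℕ → ℕ} (hq : 1 < q) (hc : IsExpansion m q 1 c) :
    q ≤ m + 1 := by
  obtain ⟨h1, h2⟩ := (isExpansion_iff hq).mp hc
  have h3 := val_le hq h1
  rw [h2, le_div_iff₀ (by linarith)] at h3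
  linarith

/-- The sequence `(c_ℓ c̄_ℓ)^∞` is an expansion of `1` in the base `q_{ℓ+1}`. -/
theorem val_periodicSeq_pairWord (ha : a ≠ []) (hT : IsTower m a.length (towerSeq m a)) {ℓ : ℕ}
    {q : ℝ} (hq : 1 < q)
    (hc : IsExpansion m q 1 (prependWord (cWord m a (ℓ + 1)) (fun _ => 0))) :
    val q (periodicSeq (pairWord m a ℓ ℓ)) = 1 := by
  obtain ⟨hcm, hcv⟩ := (isExpansion_iff hq).mp hc
  obtain ⟨h1, h2, h3⟩ := periodicSeq_pairWord ha hT ℓ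
  have hlen := length_cWord m ha (ℓ + 1)
  have hplen := length_pairWord m ha ℓ ℓ
  have hdouble : a.length * 2 ^ (ℓ + 1) = a.length * 2 ^ ℓ + a.length * 2 ^ ℓ := by
    rw [pow_succ]; ring
  have hpos := hT.len_pos ℓ
  have hcC := agree_prependWord_cWord (m := m) ha (ℓ + 1) (fun _ => 0)
  have hs := hT.succ_last ℓ
  have hs' := fun i => hT.succ_lt (k := ℓ) (i := i)
  have hper := shift_periodicSeq (pairWord m a ℓ ℓ)
  rw [hplen, ← hdouble] at hper
  set g := periodicSeq (pairWord m a ℓ ℓ)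
  set c := prependWord (cWord m a (ℓ + 1)) (fun _ => 0) with hcdef
  have hsecond : ∀ e < a.length * 2 ^ ℓ,
      g (a.length * 2 ^ ℓ + e) = m - towerSeq m a e := fun e he => by
    have h4 := congrFun h3 e
    rw [h2 e he] at h4
    have := h1 (a.length * 2 ^ ℓ + e)
    simp only [reflectSeq, shift] at h4
    omega
  refine val_periodic_eq_one hq (hT.len_pos (ℓ + 1)) hcm h1 hcv (fun i hi => ?_) hper
    (fun i hi => ?_) ?_
  · rw [hcdef, prependWord, if_neg (by omega)]
  · rw [hcC i (by omega)]
    rcases Nat.lt_or_ge i (a.length * 2 ^ ℓ) with h | h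
    · exact h2 i h
    · obtain ⟨e, rfl⟩ := Nat.exists_eq_add_of_le h
      rw [hsecond e (by omega), hs' e (by omega)]
  · have h4 : a.length * 2 ^ (ℓ + 1) - 1 = a.length * 2 ^ ℓ + (a.length * 2 ^ ℓ - 1) := by omega
    rw [hcC _ (by omega), h4, hsecond _ (by omega), hs]

theorem HasBlockForm.isUnivoque {b : ℕ → ℕ} {ℓ : ℕ} {p q : ℝ} (ha : a ≠ [])
    (hT : IsTower m a.length (towerSeq m a)) (hm : ∀ i, periodicSeq a i ≤ m)
    (hsh : ∀ k, toLex (shift k (periodicSeq a)) ≤ toLex (periodicSeq a))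
    (hrefl : ∀ k, toLex (reflectSeq m (shift k (periodicSeq a))) ≤ toLex (periodicSeq a))
    (hp1 : 1 < p) (hc : IsExpansion m p 1 (prependWord (cWord m a ℓ) (fun _ => 0)))
    (hpq : p < q) (hb : HasBlockForm m a ℓ b) : IsUnivoque m q b := by
  obtain ⟨hcm, hcv⟩ := (isExpansion_iff hp1).mp hc
  obtain ⟨h1, h2, h3, -⟩ := hb.tails_below ha hT hm hsh hrefl
  have hag := agree_prependWord_cWord (m := m) ha ℓ (fun _ => 0)
  have h0 : 0 < prependWord (cWord m a ℓ) (fun _ => 0) 0 := by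
    rw [hag 0 (hT.len_pos ℓ)]
    have := hT.reflect_lt
    omega
  have hlt := val_lt_of_base_lt hp1 hpq hcm h0
  rw [hcv] at hlt
  exact isUnivoque_of_lex (hp1.trans hpq) h1 hcm hlt.le (Or.inl hlt)
    (fun i hi => ((h2 i hi).congr (fun _ _ => rfl) hag.symm).lex_lt)
    (fun i hi => ((h3 i hi).congr (fun _ _ => rfl) hag.symm).lex_lt)

theorem HasBlockForm.not_isUnivoque {b : ℕ → ℕ} {ℓ : ℕ} {q : ℝ} (ha : a ≠ [])
    (hT : IsTower m a.length (towerSeq m a)) (hm : ∀ i, periodicSeq a i ≤ m)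
    (hsh : ∀ k, toLex (shift k (periodicSeq a)) ≤ toLex (periodicSeq a))
    (hrefl : ∀ k, toLex (reflectSeq m (shift k (periodicSeq a))) ≤ toLex (periodicSeq a))
    (hq : 1 < q) (hv : val q (periodicSeq a) = 1) (hb : HasBlockForm m a ℓ b) :
    ¬ IsUnivoque m q b := by
  obtain ⟨h1, -, -, i, hi, hA⟩ := hb.tails_below ha hT hm hsh hrefl
  exact fun h => absurd ((h.2 i).1 hi) (not_lt.mpr (one_le_val hq hm (fun _ => h1 _) hv hsh hA))

/-- A sequence that is univoque in the base `q_{ℓ+1}` but not in `q₀` has the block form. -/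
theorem hasBlockForm_of_isUnivoque {b : ℕ → ℕ} {ℓ : ℕ} {q₀ p : ℝ} (ha : a ≠ [])
    (hT : IsTower m a.length (towerSeq m a)) (hm : ∀ i, periodicSeq a i ≤ m)
    (hlast : periodicSeq a (a.length - 1) < m)
    (hsh : ∀ k, toLex (shift k (periodicSeq a)) ≤ toLex (periodicSeq a))
    (hrefl : ∀ k, toLex (reflectSeq m (shift k (periodicSeq a))) ≤ toLex (periodicSeq a))
    (hℓ : 1 ≤ ℓ) (hq₀ : 1 < q₀) (hv : val q₀ (periodicSeq a) = 1)
    (hpos : ∀ k, 0 < val q₀ (shift k (periodicSeq a))) (hp : 1 < p)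
    (hc : IsExpansion m p 1 (prependWord (cWord m a (ℓ + 1)) (fun _ => 0)))
    (hb : IsUnivoque m p b) (hb₀ : ¬ IsUnivoque m q₀ b) :
    HasBlockForm m a ℓ b ∨ HasBlockForm m a ℓ (reflectSeq m b) := by
  obtain ⟨h1, h2, h3⟩ := periodicSeq_pairWord ha hT ℓ
  have hgv := val_periodicSeq_pairWord ha hT hp hc
  have hgsh := fun k => (hT.shift_le_of_periodic h2 h3 h1 k).1
  have hlex := hb.lex_lt hp h1 hgv hgsh
  have hlex' := hb.reflect.lex_lt hp h1 hgv hgsh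
  have hbm := hb.1
  -- If no tail reached a^∞, then `b` would be univoque in q₀. The first index where `b` or its
  -- reflection violates the bound decides which of the two has the block form.
  have hex : ∃ i, (b i < m ∧ toLex (periodicSeq a) ≤ toLex (shift (i + 1) b)) ∨
      (0 < b i ∧ toLex (periodicSeq a) ≤ toLex (reflectSeq m (shift (i + 1) b))) := by
    by_contra hcon
    push Not at hcon
    exact hb₀ (isUnivoque_of_lex hq₀ hbm hm hv.le (Or.inr hpos) (fun i => (hcon i).1)
      fun i => (hcon i).2)
  classical
  have hmin : ∀ i < Nat.find hex, (b i < m → toLex (shift (i + 1) b) < toLex (periodicSeq a)) ∧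
      (0 < b i → toLex (reflectSeq m (shift (i + 1) b)) < toLex (periodicSeq a)) := by
    intro i hi
    have := Nat.find_min hex hi
    push Not at this
    exact this
  rcases Nat.find_spec hex with ⟨h4, h5⟩ | ⟨h4, h5⟩
  · exact Or.inl (hasBlockForm_of_lex ha hT hm hlast hsh hrefl hℓ h2 h3 h1 hbm
      (fun i => (hlex i).1) (fun i => (hlex i).2) h4 h5 (fun i hi => (hmin i hi).1)
      fun i hi => (hmin i hi).2)
  · refine Or.inr (hasBlockForm_of_lex ha hT hm hlast hsh hrefl hℓ h2 h3 h1 (reflectSeq_le m b)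
      (fun i => (hlex' i).1) (fun i => (hlex' i).2) (p := Nat.find hex) ?_ ?_
      (fun i hi hlt => ?_) fun i hi hlt => ?_)
    · have := hbm (Nat.find hex)
      simp only [reflectSeq]; omega
    · rw [shift_reflectSeq]; exact h5
    · rw [shift_reflectSeq]
      exact (hmin i hi).2 (by simp only [reflectSeq] at hlt; omega)
    · rw [shift_reflectSeq, reflectSeq_reflectSeq (s := shift _ b) fun i => hbm _]
      exact (hmin i hi).1 (by simp only [reflectSeq] at hlt; omega)

theorem val_shift_periodicSeq_pos {q : ℝ} (hq : 1 < q) (ha : a ≠ [])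
    (hm : ∀ i, periodicSeq a i ≤ m) (h0 : 0 < periodicSeq a 0) (k : ℕ) :
    0 < val q (shift k (periodicSeq a)) := by
  have hn := List.length_pos_iff.mpr ha
  have h1 := congrFun (shift_mul_of_shift (shift_periodicSeq a) k) 0
  have h2 : k ≤ k * a.length := Nat.le_mul_of_pos_right _ hn
  refine val_pos (i := k * a.length - k) hq (fun i => hm _) ?_
  simp only [shift, add_zero] at *
  rw [Nat.add_sub_cancel' h2, h1]
  exact h0

/-- The last digit of the period of `α(q)` is smaller than `m` if `q < m + 1`. -/
theorem last_lt_of_lt {q : ℝ} (hq : 1 < q) (hqm : q < m + 1) (ha : a ≠ [])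
    (hm : ∀ i, periodicSeq a i ≤ m) (hv : val q (periodicSeq a) = 1)
    (hsh : ∀ k, toLex (shift k (periodicSeq a)) ≤ toLex (periodicSeq a)) :
    periodicSeq a (a.length - 1) < m := by
  have hn := List.length_pos_iff.mpr ha
  by_contra hlast
  have hlast' : periodicSeq a (a.length - 1) = m := le_antisymm (hm _) (not_lt.mp hlast)
  have hper := shift_periodicSeq a
  set A := periodicSeq a
  have h0 : A 0 = m := by
    have := lex_le_head (hsh (a.length - 1))
    simp only [shift, add_zero] at this
    have := hm 0
    omega
  have h1 : toLex (shift 1 (shift (a.length - 1) A)) ≤ toLex (shift 1 A) :=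
    lex_le_shift (fun i hi => by
      obtain rfl : i = 0 := by omega
      simp [shift, hlast', h0]) (hsh _)
  rw [shift_shift, Nat.sub_add_cancel hn, hper] at h1
  -- A period ending in m forces A = m^∞, hence q = m + 1.
  have h2 : shift 1 A = A := toLex.injective (le_antisymm (hsh 1) h1)
  have h3 := val_head hq hm
  rw [h2, hv, h0] at h3
  linarith

end Bases

end UniqueExpansion

theorem corollary5p6 (m : ℕ) (hm : 1 ≤ m) (q₀ q₀' : ℝ)
    (hcomp : UniqueExpansion.IsComponent m q₀ q₀')
    (hq₀ : ((m / 2 + 1 : ℕ) : ℝ) < q₀)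
    (a : List ℕ) (ha : UniqueExpansion.IsSmallestPeriodicBlock m q₀ a)
    (ℓ : ℕ) (hℓ : 1 ≤ ℓ) (p p' : ℝ)
    -- `p = q_ℓ` and `p' = q_{ℓ+1}`: the greedy expansions of `1` are `c_ℓ 0^∞`, `c_{ℓ+1} 0^∞`
    (hp1 : 1 < p)
    (hp : UniqueExpansion.IsGreedy m p 1
      (UniqueExpansion.prependWord (UniqueExpansion.cWord m a ℓ) (fun _ => 0)))
    (hp1' : 1 < p')
    (hp' : UniqueExpansion.IsGreedy m p' 1
      (UniqueExpansion.prependWord (UniqueExpansion.cWord m a (ℓ + 1)) (fun _ => 0)))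
    (q : ℝ) (hq : q ∈ Set.Ioc p p') (b : ℕ → ℕ) :
    b ∈ UniqueExpansion.univoqueSeqs m q \ UniqueExpansion.univoqueSeqs m q₀ ↔
      UniqueExpansion.HasBlockForm m a ℓ b ∨
      ∃ b', UniqueExpansion.HasBlockForm m a ℓ b' ∧ b = UniqueExpansion.reflectSeq m b' := by
  obtain ⟨hane, hA, hmin⟩ := ha
  have hq₀1 : 1 < q₀ := by
    have : (1 : ℝ) ≤ ((m / 2 + 1 : ℕ) : ℝ) := by exact_mod_cast Nat.le_add_left 1 _
    linarith
  have hq₀m := hcomp.lt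
  obtain ⟨hAm, hAv⟩ := (UniqueExpansion.isExpansion_iff hq₀1).mp hA.1
  have h0 := hA.lt_head hm hq₀m.le hq₀
  have hpos := UniqueExpansion.val_shift_periodicSeq_pos hq₀1 hane hAm (by omega)
  have hsh := hA.shift_le hq₀1 hq₀m.le hpos
  have hrefl := hA.reflect_shift_le hq₀1 hq₀m.le hpos h0 (hcomp.frequently_mem hq₀)
  have hlast := UniqueExpansion.last_lt_of_lt hq₀1 hq₀m hane hAm hAv hsh
  have hT := UniqueExpansion.isTower_towerSeq hane hmin hAm hlast h0 hsh hrefl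
  have hq1 : 1 < q := hp1.trans hq.1
  have hqm : q ≤ m + 1 := hq.2.trans (UniqueExpansion.le_of_isExpansion hp1' hp'.1)
  rw [Set.mem_sdiff, UniqueExpansion.mem_univoqueSeqs_iff hq1 hqm,
    UniqueExpansion.mem_univoqueSeqs_iff hq₀1 hq₀m.le]
  constructor
  · rintro ⟨h1, h2⟩
    rcases UniqueExpansion.hasBlockForm_of_isUnivoque hane hT hAm hlast hsh hrefl hℓ hq₀1 hAv hpos
      hp1' hp'.1 (h1.mono_base hq1 hq.2) h2 with h | h
    · exact Or.inl h
    · exact Or.inr ⟨_, h, (UniqueExpansion.reflectSeq_reflectSeq h1.1).symm⟩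
  · rintro (h | ⟨b', h, rfl⟩)
    · exact ⟨h.isUnivoque hane hT hAm hsh hrefl hp1 hp.1 hq.1,
        h.not_isUnivoque hane hT hAm hsh hrefl hq₀1 hAv⟩
    · have h1 := h.isUnivoque hane hT hAm hsh hrefl hp1 hp.1 hq.1
      refine ⟨h1.reflect, fun h2 => h.not_isUnivoque hane hT hAm hsh hrefl hq₀1 hAv ?_⟩
      have h3 := h2.reflect
      rwa [UniqueExpansion.reflectSeq_reflectSeq h1.1] at h3
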